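/- Let $\mathcal D$ be a distribution over $(x,y)\in\mathbb R^d\times\{\pm1\}$, let $p,q\in[1,\infty]$ with $1/p+1/q=1$, and assume $\|x\|_p\le 1$ almost surely. For a radius $r\ge 0$ and $w\in\mathbb R^d$ let $$\mathrm{err}^{p,r}(w)=\mathbb P_{(x,y)\sim\mathcal D}\big[\exists x':\ \|x-x'\|_p\le r,\ y\ne\mathrm{sgn}(w^\top x')\big],\qquad \mathsf{OPT}_{p,r}=\min_{\|w\|_q=1}\mathrm{err}^{p,r}(w),$$ where $\mathrm{sgn}$ takes values in $\{\pm1\}$ with $\mathrm{sgn}(0)=1$, and let $\bar v$ with $\|\bar v\|_q=1$ attain the minimum. Let $\phi:\mathbb R\to\mathbb R$ be an $\ell_q$ soft margin function of $\bar v$: $\mathbb P(|\bar v^\top x|\le t)\le\phi(t)$ for all $t\in[0,1]$. Let $\ell:\mathbb R\to[0,\infty)$ be convex, decreasing (not necessarily strictly) and 1-Lipschitz. Let $H=4$ if $p\le 2$ and $H=4d$ if $p>2$. Let $\varepsilon>0$ and $0<\eta\le\varepsilon H^{-1}/4$, and write $\ell^{-1}(\varepsilon)$ for any $z\ge0$ with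 $\ell(z)=\varepsilon$, assumed to exist. Let $\gamma>0$; if $r+\gamma>1$, assume also $\phi(r+\gamma)\ge 1$. Let $\delta>0$ and $n\ge1$. Given a sample $S=\{(x_i,y_i)\}_{i=1}^n\sim\mathcal D^n$, full-batch adversarial training starts from $w_0=0$ and iterates $$w_{k+1}=w_k-\frac{\eta}{n}\sum_{i=1}^n\ell'\big(y_iw_k^\top(x_i+\delta_{i,k})\big)\,y_i\,(x_i+\delta_{i,k}),\qquad \delta_{i,k}\in\arg\max_{\|\delta'\|_p\le r}\ell\big(y_iw_k^\top(x_i+\delta')\big),$$ with any choice of the maximizers and of subgradients $\ell'$ where $\ell$ is not differentiable. Let $$K=d^{\,|2/q-1|}\,\varepsilon^{-1}\eta^{-1}\,\big(\ell^{-1}(\varepsilon)\big)^{2}\gamma^{-2}.$$ Then with probability at least $1-\delta$ over $S$, for every such run of $\lfloor K\rfloor$ iterations, there exists an integer $0\le k^*\le K$ such that $$\begin{aligned}\mathrm{err}^{p,r}(w_{k^*})\le{}&\big(1+(1+r)\,\ell(0)^{-1}\ell^{-1}(\varepsilon)\gamma^{-1}\big)\mathsf{OPT}_{p,r}+\phi(r+\gamma)+2\,\ell(0)^{-1}\varepsilon\\&+4\,\ell(0)^{-1}\bar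 B\gamma^{-1}\ell^{-1}(\varepsilon)\,\mathfrak R_p+\ell(0)^{-1}\Big[\frac{4\bar B\gamma^{-1}\ell^{-1}(\varepsilon)\,r}{\sqrt n}+6B\sqrt{\frac{\log(2\max\{1,K\}/\delta)}{n}}\Big],\end{aligned}$$ where $B=\ell(0)+2d^{|1/q-1/2|}(1+r)\gamma^{-1}\ell^{-1}(\varepsilon)$, $\bar B=2d^{|1/q-1/2|}B$, and $\mathfrak R_p=n^{-1}\,\mathbb E_{\sigma}\big\|\sum_{i=1}^n\sigma_ix_i\big\|_p$ with $\sigma_1,\dots,\sigma_n$ i.i.d. uniform on $\{\pm1\}$. -/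

import Mathlib

open MeasureTheory
open scoped ENNReal

noncomputable section

/-- The `ℓ_p` norm of a vector of `ℝ^d`, for `p ∈ [1, ∞]` (`p = ∞` is the maximum norm). -/
def vecNorm {d : ℕ} (p : ℝ≥0∞) (x : Fin d → ℝ) : ℝ :=
  ‖(WithLp.toLp p x : PiLp p (fun _ : Fin d => ℝ))‖

/-- The sign of a real number, with values in `{+1, -1}`. -/
def sgn (t : ℝ) : ℝ := if 0 ≤ t then 1 else -1

/-- The `ℓ_p` robust error at radius `r` of the halfspace `x ↦ sgn (w · x)`, for a distribution
`D` of labelled examples `(x, y)`. -/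
def robustErr {d : ℕ} (D : Measure ((Fin d → ℝ) × ℝ)) (p : ℝ≥0∞) (r : ℝ) (w : Fin d → ℝ) : ℝ :=
  D.real {s | ∃ x' : Fin d → ℝ, vecNorm p (s.1 - x') ≤ r ∧ s.2 ≠ sgn (w ⬝ᵥ x')}

/-- The best `ℓ_p` robust error at radius `r` of a halfspace with `ℓ_q`-normalized weights. -/
def robustOpt {d : ℕ} (D : Measure ((Fin d → ℝ) × ℝ)) (p q : ℝ≥0∞) (r : ℝ) : ℝ :=
  ⨅ w : {w : Fin d → ℝ // vecNorm q w = 1}, robustErr D p r w.1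

/-- The unit vector `v` satisfies the `ℓ_q` soft margin condition with respect to `φ`. -/
def SoftMargin {d : ℕ} (D : Measure ((Fin d → ℝ) × ℝ)) (q : ℝ≥0∞) (v : Fin d → ℝ)
    (φ : ℝ → ℝ) : Prop :=
  vecNorm q v = 1 ∧ ∀ t ∈ Set.Icc (0 : ℝ) 1, D.real {s | |v ⬝ᵥ s.1| ≤ t} ≤ φ t

/-- `g` is a subgradient of `ℓ` at `a`; for convex `ℓ` this means `g = ℓ' a` wherever `ℓ` is
differentiable. -/
def IsSubgradient (ℓ : ℝ → ℝ) (a g : ℝ) : Prop := ∀ b : ℝ, ℓ a + g * (b - a) ≤ ℓ b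

/-- `w 0, …, w K` are the iterates of `K` steps of full-batch adversarial training with step size
`η` on the sample `S`. In each step every example is perturbed by some maximizer of its loss over
the `ℓ_p` ball of radius `r`, and a gradient step is taken at the perturbed examples, which are
treated as constants. Any choice of maximizers, and of subgradients at kinks of `ℓ`, is allowed. -/
def IsAdvTraining {d n : ℕ} (ℓ : ℝ → ℝ) (p : ℝ≥0∞) (r η : ℝ) (S : Fin n → (Fin d → ℝ) × ℝ)
    (K : ℕ) (w : ℕ → Fin d → ℝ) : Prop :=
  ∀ k < K, ∃ (δ : Fin n → Fin d → ℝ) (g : Fin n → ℝ),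
    (∀ i, vecNorm p (δ i) ≤ r ∧
      ∀ δ' : Fin d → ℝ, vecNorm p δ' ≤ r →
        ℓ ((S i).2 * (w k ⬝ᵥ ((S i).1 + δ'))) ≤ ℓ ((S i).2 * (w k ⬝ᵥ ((S i).1 + δ i)))) ∧
    (∀ i, IsSubgradient ℓ ((S i).2 * (w k ⬝ᵥ ((S i).1 + δ i))) (g i)) ∧
    w (k + 1) = w k - (η / n) • ∑ i, (g i * (S i).2) • ((S i).1 + δ i)

/-- `n⁻¹ 𝔼_σ ‖∑ i, σ_i x_i‖_p`, where the `σ_i` are independent uniform random signs. -/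
def rademacherNorm {d n : ℕ} (p : ℝ≥0∞) (x : Fin n → Fin d → ℝ) : ℝ :=
  (n : ℝ)⁻¹ * (((2 : ℝ) ^ n)⁻¹ *
    ∑ σ : Fin n → Bool, vecNorm p (∑ i, (if σ i then (1 : ℝ) else -1) • x i))

end

/-! The argument compares adversarial training with the scaled optimum `V = (z / γ) • v`. The
worst-case margin of `w` at `(x, y)` over the `ℓ_p` ball is `y (w · x) - r ‖w‖_*`, with `‖·‖_*` the
dual norm, so the adversarial loss is explicit and each estimate is made on it.

Optimization (`IsAdvTraining.exists_advRisk_le`): while the empirical adversarial loss exceeds that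
of `V` by more than `ε`, a gradient step lowers `‖w - V‖_2²` by at least `η ε`. The budget `‖V‖_2²`
is spent within `K` steps, so some iterate has excess at most `ε`; the first such iterate satisfies
`‖w‖_2 ≤ 2 ‖V‖_2`.

Population loss (`mul_robustErr_le_integral`, `integral_advLoss_smul_le`): the adversarial loss
dominates `ℓ 0` times the robust error. For `V` it is at most `ℓ 0 + (1 + r) z / γ` on robust
mistakes of `v`, at most `ℓ 0` near its hyperplane, and at most `ε` elsewhere.

Generalization (`exists_measurableSet_advRisk_deviation`): the worst-case margin is an inner product
in a Hilbert space with one extra coordinate. Uniform deviations over a ball are controlled by a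
direct exponential moment: symmetrization with a ghost sample, the contraction principle for
exponentials, and a dimension-free bound for `exp ‖∑ σ_i x_i‖` obtained from `cosh`. One event
covers a whole ball of weights, hence every iterate of every run, with no union bound over steps.
The resulting estimate already lies below the `6 B √(log / n)` term; the terms in `rademacherNorm`
and in `r / √n` are nonnegative and are only added at the end. -/

/-! ### Sign patterns and a convexity inequality for powers. -/

/-- The real sign encoded by a Boolean. -/
def boolSign (b : Bool) : ℝ := if b then 1 else -1

theorem boolSign_true : boolSign true = 1 := rfl

theorem boolSign_false : boolSign false = -1 := rfl

theorem sum_boolFun_succ {n : ℕ} (f : (Fin (n + 1) → Bool) → ℝ) :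
    ∑ σ, f σ = ∑ σ : Fin n → Bool,
      (f (Fin.cons true σ) + f (Fin.cons false σ)) := by
  rw [← (Fin.consEquiv (fun _ : Fin (n + 1) => Bool)).sum_comp, Fintype.sum_prod_type_right]
  refine Finset.sum_congr rfl fun σ _ => ?_
  rw [Fintype.sum_bool]
  rfl

/-- Both `a` and `b` are convex combinations of `c` and `d` with exchanged weights, and `t ↦ t ^ k`
is convex on the nonnegative reals. -/
theorem pow_add_pow_le_of_add_eq {a b c d : ℝ} (k : ℕ) (hd : 0 ≤ d) (hda : d ≤ a) (hac : a ≤ c)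
    (hs : a + b = c + d) : a ^ k + b ^ k ≤ c ^ k + d ^ k := by
  rcases eq_or_lt_of_le (hda.trans hac) with h | h
  · have h1 : a = c := le_antisymm hac (h ▸ hda)
    have h2 : b = d := by linarith
    rw [h1, h2]
  · have hcd : 0 < c - d := by linarith
    set θ := (a - d) / (c - d) with hθ
    have h0 : 0 ≤ θ := div_nonneg (by linarith) hcd.le
    have h1 : θ ≤ 1 := (div_le_one hcd).2 (by linarith)
    have ea : a = θ * c + (1 - θ) * d := by rw [hθ]; field_simp; ring
    have eb : b = (1 - θ) * c + θ * d := by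
      have : b = c + d - a := by linarith
      rw [this, ea]; ring
    have hc : 0 ≤ c := by linarith
    have k1 := (convexOn_pow k).2 (x := c) hc (y := d) hd h0 (by linarith : 0 ≤ 1 - θ) (by ring)
    have k2 := (convexOn_pow k).2 (x := c) hc (y := d) hd (by linarith : 0 ≤ 1 - θ) h0 (by ring)
    simp only [smul_eq_mul] at k1 k2
    rw [← ea] at k1
    rw [← eb] at k2
    linarith

/-! ### Exponential moments of Rademacher sums in an inner product space. -/

section InnerProduct

variable {H : Type*} [NormedAddCommGroup H] [InnerProductSpace ℝ H]

/-- By the parallelogram law the pairs `‖a ± x‖²` and `(‖a‖ ± ‖x‖)²` have equal sums, and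
Cauchy–Schwarz puts the first pair between the members of the second. Since `cosh` is a power series
in the square with nonnegative coefficients, the power inequality applies term by term. -/
theorem cosh_norm_add_add_cosh_norm_sub_le (a x : H) :
    Real.cosh ‖a + x‖ + Real.cosh ‖a - x‖ ≤ 2 * (Real.cosh ‖a‖ * Real.cosh ‖x‖) := by
  have e : 2 * (Real.cosh ‖a‖ * Real.cosh ‖x‖)
      = Real.cosh (‖a‖ + ‖x‖) + Real.cosh (‖a‖ - ‖x‖) := by
    rw [Real.cosh_add, Real.cosh_sub]; ring
  rw [e]
  refine hasSum_le (fun k => ?_) ((Real.hasSum_cosh _).add (Real.hasSum_cosh _))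
    ((Real.hasSum_cosh _).add (Real.hasSum_cosh _))
  rw [← add_div, ← add_div]
  refine div_le_div_of_nonneg_right ?_ (by positivity)
  simp only [pow_mul]
  have h1 := norm_add_sq_real a x
  have h2 := norm_sub_sq_real a x
  have h3 := abs_le.1 (abs_real_inner_le_norm a x)
  refine pow_add_pow_le_of_add_eq k (sq_nonneg _) ?_ ?_ ?_ <;> nlinarith

theorem sum_cosh_norm_le {n : ℕ} (x : Fin n → H) (a : H) :
    ∑ σ : Fin n → Bool, Real.cosh ‖a + ∑ i, boolSign (σ i) • x i‖
      ≤ 2 ^ n * (Real.cosh ‖a‖ * ∏ i, Real.cosh ‖x i‖) := by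
  induction n generalizing a with
  | zero => simp
  | succ n ih =>
    rw [sum_boolFun_succ, Finset.sum_add_distrib]
    simp only [Fin.sum_univ_succ, Fin.cons_zero, Fin.cons_succ, boolSign_true, boolSign_false,
      one_smul, neg_smul, ← add_assoc, ← sub_eq_add_neg]
    have h1 := ih (fun i => x i.succ) (a + x 0)
    have h2 := ih (fun i => x i.succ) (a - x 0)
    have h3 := cosh_norm_add_add_cosh_norm_sub_le a (x 0)
    have h4 : 0 ≤ (2 : ℝ) ^ n * ∏ i : Fin n, Real.cosh ‖x i.succ‖ :=
      mul_nonneg (by positivity) (Finset.prod_nonneg fun i _ => (Real.cosh_pos _).le)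
    rw [Fin.prod_univ_succ]
    have h5 := mul_le_mul_of_nonneg_left h3 h4
    refine (add_le_add h1 h2).trans (le_of_eq_of_le ?_ (h5.trans_eq ?_)) <;> ring

/-- The factor 2 is the price of `exp t ≤ 2 cosh t`; after that `cosh t ≤ exp (t ^ 2 / 2)` bounds
each factor, and the dimension never enters. -/
theorem sum_exp_norm_le {n : ℕ} (x : Fin n → H) {R : ℝ} (hx : ∀ i, ‖x i‖ ≤ R) :
    ∑ σ : Fin n → Bool, Real.exp ‖∑ i, boolSign (σ i) • x i‖
      ≤ 2 ^ n * (2 * Real.exp (n * R ^ 2 / 2)) := by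
  have h := sum_cosh_norm_le x 0
  simp only [zero_add, norm_zero, Real.cosh_zero, one_mul] at h
  have h1 : ∀ t : ℝ, Real.exp t ≤ 2 * Real.cosh t := fun t => by
    rw [Real.cosh_eq]; linarith [Real.exp_pos (-t)]
  have h2 : ∏ i, Real.cosh ‖x i‖ ≤ Real.exp (n * R ^ 2 / 2) := by
    calc ∏ i, Real.cosh ‖x i‖ ≤ ∏ _i : Fin n, Real.exp (R ^ 2 / 2) := by
          refine Finset.prod_le_prod (fun i _ => (Real.cosh_pos _).le) fun i _ => ?_
          refine (Real.cosh_le_exp_half_sq _).trans (Real.exp_le_exp.2 ?_)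
          have := pow_le_pow_left₀ (norm_nonneg _) (hx i) 2
          linarith
      _ = _ := by
          rw [Finset.prod_const, Finset.card_univ, Fintype.card_fin, ← Real.exp_nat_mul]
          congr 1; ring
  calc _ ≤ ∑ σ : Fin n → Bool, 2 * Real.cosh ‖∑ i, boolSign (σ i) • x i‖ :=
        Finset.sum_le_sum fun σ _ => h1 _
    _ ≤ 2 * (2 ^ n * Real.exp (n * R ^ 2 / 2)) := by
        rw [← Finset.mul_sum]
        refine mul_le_mul_of_nonneg_left (h.trans ?_) zero_le_two
        exact mul_le_mul_of_nonneg_left h2 (by positivity)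
    _ = _ := by ring

end InnerProduct

/-! ### The contraction principle for exponential moments. -/

theorem exp_add_exp_le_of_le {A C A' C' : ℝ} (h1 : C' ≤ A) (h2 : C' ≤ C)
    (h3 : A + C ≤ A' + C') : Real.exp A + Real.exp C ≤ Real.exp A' + Real.exp C' := by
  have h4 : Real.exp A * Real.exp (C - C') ≤ Real.exp A' := by
    rw [← Real.exp_add]; exact Real.exp_le_exp.2 (by linarith)
  have h5 : Real.exp C = Real.exp C' * Real.exp (C - C') := by
    rw [← Real.exp_add]; congr 1; ring
  have h6 := Real.exp_le_exp.2 h1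
  have h7 : 1 ≤ Real.exp (C - C') := Real.one_le_exp (by linarith)
  rw [h5]
  nlinarith

/-- The comparison behind the contraction principle, in one coordinate: `s` maximizes `a + φ` and
`s'` maximizes `a - φ`. -/
theorem exp_add_exp_le_of_contraction {a a' φ φ' t t' M₁ M₂ : ℝ} (h : |φ| ≤ |t|) (h' : |φ'| ≤ |t'|)
    (hL : |φ - φ'| ≤ |t - t'|) (hs : a' + φ' ≤ a + φ) (hs' : a - φ ≤ a' - φ')
    (h1 : Real.exp (a + t) ≤ M₁) (h1' : Real.exp (a' + t') ≤ M₁)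
    (h2 : Real.exp (a - t) ≤ M₂) (h2' : Real.exp (a' - t') ≤ M₂) :
    Real.exp (a + φ) + Real.exp (a' - φ') ≤ M₁ + M₂ := by
  have hφ := abs_le.1 h
  have hφ' := abs_le.1 h'
  have hd := abs_le.1 hL
  -- If `t` and `t'` have opposite signs, monotonicity of `exp` suffices. With equal signs, the
  -- larger of `t`, `t'` decides which point takes the plus sign on the right; the Lipschitz
  -- condition compares the sums of exponents, and maximality shows that the new pair contains the
  -- smallest exponent.
  have key : (Real.exp (a + φ) + Real.exp (a' - φ') ≤ Real.exp (a + t) + Real.exp (a' - t')) ∨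
      (Real.exp (a + φ) + Real.exp (a' - φ') ≤ Real.exp (a' + t') + Real.exp (a - t)) := by
    rcases le_total 0 t with p | p <;> rcases le_total 0 t' with p' | p' <;>
      simp only [abs_of_nonneg, abs_of_nonpos, p, p'] at hφ hφ'
    · rcases le_total t' t with q | q
      · left
        rw [abs_of_nonneg (by linarith)] at hd
        exact exp_add_exp_le_of_le (by linarith) (by linarith) (by linarith)
      · right
        rw [abs_of_nonpos (by linarith)] at hd
        rw [add_comm (Real.exp (a + φ))]
        exact exp_add_exp_le_of_le (by linarith) (by linarith) (by linarith)
    · left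
      exact add_le_add (Real.exp_le_exp.2 (by linarith)) (Real.exp_le_exp.2 (by linarith))
    · right
      rw [add_comm (Real.exp (a + φ))]
      exact add_le_add (Real.exp_le_exp.2 (by linarith)) (Real.exp_le_exp.2 (by linarith))
    · rcases le_total t' t with q | q
      · left
        rw [abs_of_nonneg (by linarith)] at hd
        rw [add_comm, add_comm (Real.exp (a + t))]
        exact exp_add_exp_le_of_le (by linarith) (by linarith) (by linarith)
      · right
        rw [abs_of_nonpos (by linarith)] at hd
        rw [add_comm (Real.exp (a' + t'))]
        exact exp_add_exp_le_of_le (by linarith) (by linarith) (by linarith)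
  rcases key with k | k <;> linarith

section Contraction

variable {ι : Type*} (F : Finset ι) (hF : F.Nonempty)

theorem sup'_exp_contraction_step (a φ t : ι → ℝ) (h : ∀ W ∈ F, |φ W| ≤ |t W|)
    (hL : ∀ W ∈ F, ∀ V ∈ F, |φ W - φ V| ≤ |t W - t V|) :
    F.sup' hF (fun W => Real.exp (a W + φ W)) + F.sup' hF (fun W => Real.exp (a W - φ W))
      ≤ F.sup' hF (fun W => Real.exp (a W + t W)) + F.sup' hF (fun W => Real.exp (a W - t W)) := by
  obtain ⟨s, hs, es⟩ := F.exists_mem_eq_sup' hF (fun W => Real.exp (a W + φ W))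
  obtain ⟨s', hs', es'⟩ := F.exists_mem_eq_sup' hF (fun W => Real.exp (a W - φ W))
  have m1 := F.le_sup' (fun W => Real.exp (a W + φ W)) hs'
  have m2 := F.le_sup' (fun W => Real.exp (a W - φ W)) hs
  rw [es] at m1 ⊢
  rw [es'] at m2 ⊢
  exact exp_add_exp_le_of_contraction (h s hs) (h s' hs') (hL s hs s' hs') (Real.exp_le_exp.1 m1)
    (Real.exp_le_exp.1 m2) (F.le_sup' (fun W => Real.exp (a W + t W)) hs)
    (F.le_sup' (fun W => Real.exp (a W + t W)) hs') (F.le_sup' (fun W => Real.exp (a W - t W)) hs)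
    (F.le_sup' (fun W => Real.exp (a W - t W)) hs')

/-- The Ledoux–Talagrand contraction principle for exponential moments. -/
theorem sum_sup'_exp_contraction {n : ℕ} (a : ι → ℝ) (φ t : ι → Fin n → ℝ)
    (h : ∀ i, ∀ W ∈ F, |φ W i| ≤ |t W i|)
    (hL : ∀ i, ∀ W ∈ F, ∀ V ∈ F, |φ W i - φ V i| ≤ |t W i - t V i|) :
    ∑ σ : Fin n → Bool, F.sup' hF (fun W => Real.exp (a W + ∑ i, boolSign (σ i) * φ W i))
      ≤ ∑ σ : Fin n → Bool, F.sup' hF (fun W => Real.exp (a W + ∑ i, boolSign (σ i) * t W i)) := by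
  induction n generalizing a with
  | zero => simp
  | succ n ih =>
    rw [sum_boolFun_succ, sum_boolFun_succ, Finset.sum_add_distrib]
    simp only [Fin.sum_univ_succ, Fin.cons_zero, Fin.cons_succ, boolSign_true, boolSign_false,
      one_mul, neg_mul, ← add_assoc, ← sub_eq_add_neg]
    -- The term of the first sign is absorbed into the offset, which is why the statement carries a
    -- general `a`. The other coordinates are contracted first, then coordinate 0 for each fixed
    -- pattern of the remaining signs.
    have h1 := ih (fun W => a W + φ W 0) (fun W i => φ W i.succ) (fun W i => t W i.succ)
      (fun i => h i.succ) (fun i => hL i.succ)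
    have h2 := ih (fun W => a W - φ W 0) (fun W i => φ W i.succ) (fun W i => t W i.succ)
      (fun i => h i.succ) (fun i => hL i.succ)
    refine (add_le_add h1 h2).trans ?_
    rw [← Finset.sum_add_distrib]
    refine Finset.sum_le_sum fun σ _ => ?_
    have := sup'_exp_contraction_step F hF (fun W => a W + ∑ i, boolSign (σ i) * t W i.succ)
      (fun W => φ W 0) (fun W => t W 0) (h 0) (hL 0)
    simpa only [add_right_comm, add_sub_right_comm] using this

end Contraction

/-- Exponential moment of the Rademacher process indexed by Lipschitz functions of linear forms
in a ball of an inner product space. -/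
theorem sum_sup'_exp_lipschitz_le {H : Type*} [NormedAddCommGroup H] [InnerProductSpace ℝ H]
    {n : ℕ} (F : Finset H) (hF : F.Nonempty) {ρ R c : ℝ} (hc : 0 ≤ c) (hW : ∀ W ∈ F, ‖W‖ ≤ ρ)
    (x : Fin n → H) (hx : ∀ i, ‖x i‖ ≤ R) {ψ : ℝ → ℝ} (hψ : LipschitzWith 1 ψ) (hψ0 : ψ 0 = 0) :
    ∑ σ : Fin n → Bool,
        F.sup' hF (fun W => Real.exp (∑ i, boolSign (σ i) * (c * ψ (inner ℝ W (x i)))))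
      ≤ 2 ^ n * (2 * Real.exp (n * (c * ρ * R) ^ 2 / 2)) := by
  have hψ' : ∀ u v, |ψ u - ψ v| ≤ |u - v| := fun u v => by
    simpa [Real.dist_eq] using hψ.dist_le_mul u v
  have hρ : 0 ≤ ρ := by
    obtain ⟨W, h⟩ := hF
    exact (norm_nonneg W).trans (hW W h)
  have h := sum_sup'_exp_contraction F hF (fun _ => 0)
    (fun W i => c * ψ (inner ℝ W (x i))) (fun W i => c * inner ℝ W (x i))
    (fun i W _ => by
      simp only [abs_mul]
      refine mul_le_mul_of_nonneg_left ?_ (abs_nonneg _)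
      simpa [hψ0] using hψ' (inner ℝ W (x i)) 0)
    (fun i W _ V _ => by
      simp only [← mul_sub, abs_mul]
      exact mul_le_mul_of_nonneg_left (hψ' _ _) (abs_nonneg _))
  simp only [zero_add] at h
  refine h.trans (le_trans (Finset.sum_le_sum fun σ _ => ?_)
    (sum_exp_norm_le (fun i => (c * ρ) • x i) (R := c * ρ * R) fun i => ?_))
  · refine Finset.sup'_le _ _ fun W hWF => Real.exp_le_exp.2 ?_
    have e : ∑ i, boolSign (σ i) * (c * inner ℝ W (x i))
        = c * inner ℝ W (∑ i, boolSign (σ i) • x i) := by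
      rw [inner_sum, Finset.mul_sum]
      refine Finset.sum_congr rfl fun i _ => ?_
      rw [inner_smul_right]; ring
    have e' : ∑ i, boolSign (σ i) • (c * ρ) • x i = (c * ρ) • ∑ i, boolSign (σ i) • x i := by
      rw [Finset.smul_sum]
      exact Finset.sum_congr rfl fun i _ => smul_comm _ _ _
    rw [e, e', norm_smul, Real.norm_of_nonneg (by positivity), mul_assoc]
    refine mul_le_mul_of_nonneg_left ((real_inner_le_norm _ _).trans ?_) hc
    exact mul_le_mul_of_nonneg_right (hW W hWF) (norm_nonneg _)
  · rw [norm_smul, Real.norm_of_nonneg (by positivity)]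
    exact mul_le_mul_of_nonneg_left (hx i) (by positivity)

/-! ### Symmetrization and an exponential tail bound. -/

section Symmetrization

variable {Z ι : Type*} [MeasurableSpace Z] (D : Measure Z) [IsProbabilityMeasure D]

theorem sum_sup'_exp_neg {n : ℕ} (F : Finset ι) (hF : F.Nonempty) (t : ι → Fin n → ℝ) :
    ∑ σ : Fin n → Bool, F.sup' hF (fun W => Real.exp (∑ i, boolSign (σ i) * -t W i))
      = ∑ σ : Fin n → Bool, F.sup' hF (fun W => Real.exp (∑ i, boolSign (σ i) * t W i)) := by
  rw [← (Equiv.piCongrRight fun _ : Fin n => Equiv.boolNot).sum_comp]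
  refine Finset.sum_congr rfl fun σ _ => ?_
  congr 1
  funext W
  congr 1
  refine Finset.sum_congr rfl fun i _ => ?_
  rcases h : σ i <;> simp [boolSign, h, Equiv.boolNot]

variable {D} in
theorem integrable_sup'_exp {F : Finset ι} (hF : F.Nonempty) {g : ι → Z → ℝ} {C : ℝ}
    (hm : ∀ W, Measurable (g W)) (hC : ∀ W s, g W s ≤ C) :
    Integrable (fun s => F.sup' hF (fun W => Real.exp (g W s))) D := by
  refine Integrable.of_bound (C := Real.exp C) ?_ (Filter.Eventually.of_forall fun s => ?_)
  · have := Finset.measurable_sup' hF (f := fun W s => Real.exp (g W s))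
      fun W _ => Real.measurable_exp.comp (hm W)
    have e : (fun s => F.sup' hF (fun W => Real.exp (g W s)))
        = F.sup' hF (fun W s => Real.exp (g W s)) := by
      funext s; rw [Finset.sup'_apply]
    rw [e]
    exact this.aestronglyMeasurable
  · obtain ⟨W, hW⟩ := hF
    have h0 : 0 ≤ F.sup' ⟨W, hW⟩ (fun W => Real.exp (g W s)) :=
      (Real.exp_pos _).le.trans (F.le_sup' (fun W => Real.exp (g W s)) hW)
    rw [Real.norm_of_nonneg h0]
    exact Finset.sup'_le _ _ fun W _ => Real.exp_le_exp.2 (hC W s)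

theorem measurePreserving_swapOn {n : ℕ} (σ : Fin n → Bool) :
    MeasurePreserving (fun (u : Fin n → Z × Z) i => if σ i then u i else (u i).swap)
      (Measure.pi fun _ => D.prod D) (Measure.pi fun _ => D.prod D) := by
  refine measurePreserving_pi (fun _ => D.prod D) (fun _ => D.prod D)
    (f := fun i u => if σ i then u else u.swap) fun i => ?_
  rcases σ i
  · simpa using Measure.measurePreserving_swap (μ := D) (ν := D)
  · simp only [if_true]
    exact MeasurePreserving.id (D.prod D)

/-- Symmetrization for the exponential moment of a finite maximum. -/
theorem integral_sup'_exp_sub_le {n : ℕ} (F : Finset ι) (hF : F.Nonempty) (f : ι → Z → ℝ) {C A : ℝ}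
    (hm : ∀ W, Measurable (f W)) (hC : ∀ W s, |f W s| ≤ C)
    (hA : ∀ s : Fin n → Z, ∑ σ : Fin n → Bool,
      F.sup' hF (fun W => Real.exp (∑ i, boolSign (σ i) * (2 * f W (s i)))) ≤ 2 ^ n * A) :
    ∫ u, F.sup' hF (fun W => Real.exp (∑ i, (f W (u i).2 - f W (u i).1)))
      ∂(Measure.pi fun _ : Fin n => D.prod D) ≤ A := by
  set π := Measure.pi fun _ : Fin n => D.prod D
  set Ψ : (Fin n → Z × Z) → ℝ :=
    fun u => F.sup' hF (fun W => Real.exp (∑ i, (f W (u i).2 - f W (u i).1))) with hΨ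
  have hint : ∀ σ : Fin n → Bool, Integrable
      (fun u => F.sup' hF (fun W => Real.exp (∑ i, boolSign (σ i) * (f W (u i).2 - f W (u i).1))))
      π := fun σ => by
    refine integrable_sup'_exp hF (C := ∑ _i : Fin n, 2 * C) (fun W => ?_) fun W u => ?_
    · refine Finset.measurable_sum _ fun i _ => Measurable.const_mul ?_ _
      exact ((hm W).comp (measurable_snd.comp (measurable_pi_apply i))).sub
        ((hm W).comp (measurable_fst.comp (measurable_pi_apply i)))
    · refine Finset.sum_le_sum fun i _ => ?_
      have h1 := abs_le.1 (hC W (u i).1)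
      have h2 := abs_le.1 (hC W (u i).2)
      rcases σ i <;> simp only [boolSign, if_true, Bool.false_eq_true, if_false] <;> linarith
  -- Swapping the two examples in the pairs selected by `σ` preserves the product measure and flips
  -- the corresponding signs.
  have hσ : ∀ σ : Fin n → Bool, ∫ u, Ψ u ∂π = ∫ u, F.sup' hF
      (fun W => Real.exp (∑ i, boolSign (σ i) * (f W (u i).2 - f W (u i).1))) ∂π := fun σ => by
    have hp := measurePreserving_swapOn D σ
    have h1 : Integrable Ψ π := by
      simpa only [boolSign, if_true, one_mul] using hint (fun _ => true)
    have h2 := integral_map hp.measurable.aemeasurable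
      (f := Ψ) (by rw [hp.map_eq]; exact h1.aestronglyMeasurable)
    rw [hp.map_eq] at h2
    rw [h2]
    refine integral_congr_ae (Filter.Eventually.of_forall fun u => ?_)
    simp only [hΨ]
    congr 1
    funext W
    congr 1
    refine Finset.sum_congr rfl fun i _ => ?_
    rcases h : σ i <;> simp [boolSign]
  have hpt : ∀ u : Fin n → Z × Z, ∑ σ : Fin n → Bool, F.sup' hF
      (fun W => Real.exp (∑ i, boolSign (σ i) * (f W (u i).2 - f W (u i).1))) ≤ 2 ^ n * A := by
    intro u
    have h1 := hA (fun i => (u i).2)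
    have h2 := hA (fun i => (u i).1)
    rw [← sum_sup'_exp_neg] at h2
    have h3 : ∑ σ : Fin n → Bool, F.sup' hF
        (fun W => Real.exp (∑ i, boolSign (σ i) * (f W (u i).2 - f W (u i).1)))
        -- Convexity of `exp` separates the sample from the ghost sample as a midpoint, which
        -- doubles `f` in the exponent; the minus sign disappears after summing over all patterns.
        ≤ ∑ σ : Fin n → Bool, (1 / 2 * F.sup' hF (fun W => Real.exp (∑ i, boolSign (σ i) *
            (2 * f W (u i).2))) + 1 / 2 * F.sup' hF (fun W => Real.exp (∑ i, boolSign (σ i) *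
            -(2 * f W (u i).1)))) := by
      refine Finset.sum_le_sum fun σ _ => Finset.sup'_le _ _ fun W hW => ?_
      have k1 := F.le_sup' (fun W => Real.exp (∑ i, boolSign (σ i) * (2 * f W (u i).2))) hW
      have k2 := F.le_sup' (fun W => Real.exp (∑ i, boolSign (σ i) * -(2 * f W (u i).1))) hW
      have k3 : ∑ i, boolSign (σ i) * (f W (u i).2 - f W (u i).1)
          = 1 / 2 * (∑ i, boolSign (σ i) * (2 * f W (u i).2))
            + 1 / 2 * (∑ i, boolSign (σ i) * -(2 * f W (u i).1)) := by
        rw [Finset.mul_sum, Finset.mul_sum, ← Finset.sum_add_distrib]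
        exact Finset.sum_congr rfl fun i _ => by ring
      have k4 := convexOn_exp.2 (Set.mem_univ (∑ i, boolSign (σ i) * (2 * f W (u i).2)))
        (Set.mem_univ (∑ i, boolSign (σ i) * -(2 * f W (u i).1)))
        (by norm_num : (0 : ℝ) ≤ 1 / 2) (by norm_num : (0 : ℝ) ≤ 1 / 2) (by norm_num)
      simp only [smul_eq_mul] at k4
      rw [k3]
      linarith
    rw [Finset.sum_add_distrib, ← Finset.mul_sum, ← Finset.mul_sum] at h3
    linarith
  have h4 : (2 : ℝ) ^ n * ∫ u, Ψ u ∂π ≤ 2 ^ n * A := by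
    calc (2 : ℝ) ^ n * ∫ u, Ψ u ∂π = ∑ _σ : Fin n → Bool, ∫ u, Ψ u ∂π := by
          simp [Finset.sum_const]
      _ = ∫ u, ∑ σ : Fin n → Bool, F.sup' hF
          (fun W => Real.exp (∑ i, boolSign (σ i) * (f W (u i).2 - f W (u i).1))) ∂π := by
          rw [integral_finsetSum _ fun σ _ => hint σ]
          exact Finset.sum_congr rfl fun σ _ => hσ σ
      _ ≤ ∫ _u, 2 ^ n * A ∂π :=
          integral_mono (integrable_finsetSum _ fun σ _ => hint σ) (integrable_const _) hpt
      _ = 2 ^ n * A := by simp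
  exact le_of_mul_le_mul_left h4 (by positivity)

/-- A tail bound for the maximal deviation of a finite class whose Rademacher process has a
bounded exponential moment. -/
theorem measureReal_exists_le_sum_le {n : ℕ} (F : Finset ι) (f : ι → Z → ℝ)
    {C A : ℝ} (hm : ∀ W, Measurable (f W)) (hC : ∀ W s, |f W s| ≤ C) (hF : F.Nonempty)
    (hA : ∀ s : Fin n → Z, ∑ σ : Fin n → Bool,
      F.sup' hF (fun W => Real.exp (∑ i, boolSign (σ i) * (2 * f W (s i)))) ≤ 2 ^ n * A) (t : ℝ) :
    (Measure.pi fun _ : Fin n => D).real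
        {S | ∃ W ∈ F, t ≤ ∑ i, (∫ s, f W s ∂D - f W (S i))} ≤ Real.exp (-t) * A := by
  set P := Measure.pi fun _ : Fin n => D
  have hfi : ∀ W, Integrable (f W) D := fun W =>
    Integrable.of_bound (hm W).aestronglyMeasurable C (Filter.Eventually.of_forall (hC W))
  set Ψ : (Fin n → Z) × (Fin n → Z) → ℝ :=
    fun u => F.sup' hF (fun W => Real.exp (∑ i, (f W (u.2 i) - f W (u.1 i)))) with hΨ
  have hb : ∀ W (S S' : Fin n → Z), ∑ i, (f W (S' i) - f W (S i)) ≤ ∑ _i : Fin n, 2 * C := by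
    intro W S S'
    refine Finset.sum_le_sum fun i _ => ?_
    have h1 := abs_le.1 (hC W (S i))
    have h2 := abs_le.1 (hC W (S' i))
    linarith
  have hm1 : ∀ W i, Measurable fun u : Fin n → Z => f W (u i) := fun W i =>
    (hm W).comp (measurable_pi_apply i)
  have hΨi : Integrable Ψ (P.prod P) := by
    refine integrable_sup'_exp hF (C := ∑ _i : Fin n, 2 * C) (fun W => ?_) fun W u => hb W _ _
    refine Finset.measurable_sum _ fun i _ => ?_
    exact ((hm1 W i).comp measurable_snd).sub ((hm1 W i).comp measurable_fst)
  have hsym : ∫ u, Ψ u ∂(P.prod P) ≤ A := by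
    have hp := measurePreserving_arrowProdEquivProdArrow Z Z (Fin n) (fun _ => D) (fun _ => D)
    have h2 := integral_map hp.measurable.aemeasurable
      (f := Ψ) (by rw [hp.map_eq]; exact hΨi.aestronglyMeasurable)
    rw [hp.map_eq] at h2
    rw [h2]
    exact integral_sup'_exp_sub_le D F hF f hm hC hA
  rw [integral_prod _ hΨi] at hsym
  -- Jensen's inequality: each true mean is the average over a ghost sample `S'`, and averaging
  -- comes out of `exp`. Markov's inequality at level `exp t` then gives the tail.
  have hJ : ∀ S : Fin n → Z, ∀ W ∈ F,
      Real.exp (∑ i, (∫ s, f W s ∂D - f W (S i))) ≤ ∫ S', Ψ (S, S') ∂P := by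
    intro S W hW
    have hint : ∀ i, Integrable (fun S' : Fin n → Z => f W (S' i)) P := fun i =>
      Integrable.of_bound (hm1 W i).aestronglyMeasurable C
        (Filter.Eventually.of_forall fun S' => hC W _)
    have hi2 : ∀ i, Integrable (fun S' : Fin n → Z => f W (S' i) - f W (S i)) P := fun i =>
      (hint i).sub (integrable_const _)
    have e : ∑ i, (∫ s, f W s ∂D - f W (S i)) = ∫ S', ∑ i, (f W (S' i) - f W (S i)) ∂P := by
      rw [integral_finsetSum _ fun i _ => hi2 i]
      refine Finset.sum_congr rfl fun i _ => ?_
      rw [integral_sub (hint i) (integrable_const _)]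
      have hp := measurePreserving_eval (fun _ : Fin n => D) i
      have h2 := integral_map hp.measurable.aemeasurable
        (f := f W) (by rw [hp.map_eq]; exact (hfi W).aestronglyMeasurable)
      rw [hp.map_eq] at h2
      rw [h2]
      simp [P]
    have hexp : Integrable (fun S' => Real.exp (∑ i, (f W (S' i) - f W (S i)))) P := by
      refine Integrable.of_bound (C := Real.exp (∑ _i : Fin n, 2 * C)) ?_
        (Filter.Eventually.of_forall fun S' => ?_)
      · exact (Real.measurable_exp.comp (Finset.measurable_sum _ fun i _ =>
          (hm1 W i).sub measurable_const)).aestronglyMeasurable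
      · rw [Real.norm_of_nonneg (Real.exp_pos _).le]
        exact Real.exp_le_exp.2 (hb W _ _)
    rw [e]
    refine (convexOn_exp.map_integral_le Real.continuous_exp.continuousOn isClosed_univ
      (Filter.Eventually.of_forall fun _ => Set.mem_univ _)
      (integrable_finsetSum _ fun i _ => hi2 i) hexp).trans ?_
    refine integral_mono hexp ?_ fun S' => ?_
    · refine integrable_sup'_exp hF (C := ∑ _i : Fin n, 2 * C) (fun W => ?_) fun W u => hb W _ _
      exact Finset.measurable_sum _ fun i _ => (hm1 W i).sub (measurable_const (a := f W (S i)))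
    · exact F.le_sup' (fun W => Real.exp (∑ i, (f W (S' i) - f W (S i)))) hW
  have hM := mul_meas_ge_le_integral_of_nonneg (μ := P) (f := fun S => ∫ S', Ψ (S, S') ∂P)
    (Filter.Eventually.of_forall fun S => by
      obtain ⟨W, hW⟩ := hF
      exact (Real.exp_pos _).le.trans (hJ S W hW)) hΨi.integral_prod_left (Real.exp t)
  have hsub : P.real {S | ∃ W ∈ F, t ≤ ∑ i, (∫ s, f W s ∂D - f W (S i))}
      ≤ P.real {S | Real.exp t ≤ ∫ S', Ψ (S, S') ∂P} := by
    refine measureReal_mono ?_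
    rintro S ⟨W, hW, h⟩
    exact (Real.exp_le_exp.2 h).trans (hJ S W hW)
  have h5 : Real.exp t * P.real {S | Real.exp t ≤ ∫ S', Ψ (S, S') ∂P} ≤ A := hM.trans hsym
  rw [Real.exp_neg, inv_mul_eq_div, le_div_iff₀ (Real.exp_pos t), mul_comm]
  exact (mul_le_mul_of_nonneg_left hsub (Real.exp_pos t).le).trans h5

end Symmetrization

/-! ### Uniform deviation of Lipschitz functions of linear forms. -/

section UniformDeviation

variable {Z H : Type*} [MeasurableSpace Z] (D : Measure Z) [IsProbabilityMeasure D]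
  [NormedAddCommGroup H] [InnerProductSpace ℝ H]

theorem abs_lipschitz_inner_sub_le {ψ : ℝ → ℝ} (hψ : LipschitzWith 1 ψ) {W x : H} {ρ R : ℝ}
    (hW : ‖W‖ ≤ ρ) (hx : ‖x‖ ≤ R) : |ψ (inner ℝ W x) - ψ 0| ≤ ρ * R := by
  have h : |ψ (inner ℝ W x) - ψ 0| ≤ |inner ℝ W x - 0| := by
    simpa [Real.dist_eq] using hψ.dist_le_mul (inner ℝ W x) 0
  rw [sub_zero] at h
  refine h.trans ((abs_real_inner_le_norm _ _).trans ?_)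
  exact mul_le_mul hW hx (norm_nonneg _) ((norm_nonneg _).trans hW)

theorem measureReal_exists_deviation_le {n : ℕ} (hn : 0 < n) {X : Z → H} {R ρ t : ℝ}
    (hXm : ∀ W, Measurable fun s => (inner ℝ W (X s) : ℝ)) (hX : ∀ s, ‖X s‖ ≤ R)
    {ψ : ℝ → ℝ} (hψ : LipschitzWith 1 ψ) {ι : Type*} (F : Finset ι) (W : ι → H)
    (hW : ∀ j, ‖W j‖ ≤ ρ) (hG : 0 < ρ * R) (ht : 0 ≤ t) :
    (Measure.pi fun _ : Fin n => D).real
        {S | ∃ j ∈ F, t ≤ ∫ s, ψ (inner ℝ (W j) (X s)) ∂D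
          - (n : ℝ)⁻¹ * ∑ i, ψ (inner ℝ (W j) (X (S i)))}
      ≤ 2 * Real.exp (-(n * t ^ 2 / (8 * (ρ * R) ^ 2))) := by
  classical
  rcases F.eq_empty_or_nonempty with rfl | hF
  · simp only [Finset.notMem_empty, false_and, exists_false, Set.ofPred_false, measureReal_empty]
    positivity
  set G := ρ * R with hGdef
  -- This `c` minimizes the exponent `-n c t + 2 n c² G²`.
  set c := t / (4 * G ^ 2) with hc
  have hc0 : 0 ≤ c := by positivity
  have hn' : (0 : ℝ) < n := by exact_mod_cast hn
  -- Contraction needs a function vanishing at 0; subtracting `ψ 0` leaves the deviations unchanged.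
  set f : ι → Z → ℝ := fun j s => c * (ψ (inner ℝ (W j) (X s)) - ψ 0) with hf
  have hψm : ∀ j, Measurable fun s => ψ (inner ℝ (W j) (X s)) := fun j =>
    hψ.continuous.measurable.comp (hXm _)
  have hint : ∀ j, Integrable (fun s => ψ (inner ℝ (W j) (X s))) D := fun j => by
    refine Integrable.of_bound (hψm j).aestronglyMeasurable (|ψ 0| + G)
      (Filter.Eventually.of_forall fun s => ?_)
    have h1 := abs_lipschitz_inner_sub_le hψ (hW j) (hX s)
    have h2 := abs_add_le (ψ 0) (ψ (inner ℝ (W j) (X s)) - ψ 0)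
    rw [add_sub_cancel] at h2
    rw [Real.norm_eq_abs]
    linarith
  have hLip : LipschitzWith 1 (fun u => ψ u - ψ 0) :=
    LipschitzWith.of_dist_le_mul fun u v => by
      simpa [Real.dist_eq] using hψ.dist_le_mul u v
  have hA : ∀ s : Fin n → Z, ∑ σ : Fin n → Bool,
      F.sup' hF (fun j => Real.exp (∑ i, boolSign (σ i) * (2 * f j (s i))))
        ≤ 2 ^ n * (2 * Real.exp (n * (2 * c * ρ * R) ^ 2 / 2)) := by
    intro s
    have h := sum_sup'_exp_lipschitz_le (F.image W) (hF.image W) (c := 2 * c) (by positivity)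
      (ρ := ρ) (R := R) (by
        intro V hV
        obtain ⟨j, _, rfl⟩ := Finset.mem_image.1 hV
        exact hW j) (fun i => X (s i)) (fun i => hX _) hLip (sub_self _)
    simp only [Finset.sup'_image] at h
    refine le_of_eq_of_le ?_ h
    refine Finset.sum_congr rfl fun σ _ => ?_
    congr 1
    funext j
    simp only [Function.comp_apply, hf]
    congr 1
    exact Finset.sum_congr rfl fun i _ => by ring
  have hmain := measureReal_exists_le_sum_le D F f (C := c * G)
    (fun j => ((hψm j).sub_const _).const_mul _)
    (fun j s => by
      rw [hf, abs_mul, abs_of_nonneg hc0]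
      exact mul_le_mul_of_nonneg_left (abs_lipschitz_inner_sub_le hψ (hW j) (hX s)) hc0)
    hF hA (n * (c * t))
  have e : Real.exp (-(n * (c * t))) * (2 * Real.exp (n * (2 * c * ρ * R) ^ 2 / 2))
      = 2 * Real.exp (-(n * t ^ 2 / (8 * G ^ 2))) := by
    rw [mul_left_comm, ← Real.exp_add]
    congr 2
    have : n * (2 * c * ρ * R) ^ 2 / 2 = 2 * n * c ^ 2 * G ^ 2 := by rw [hGdef]; ring
    rw [this, hc]
    field_simp
    ring
  rw [e] at hmain
  refine le_trans (measureReal_mono ?_) hmain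
  rintro S ⟨j, hj, h⟩
  refine ⟨j, hj, ?_⟩
  have e2 : ∑ i, (∫ s, f j s ∂D - f j (S i)) = n * (c * (∫ s, ψ (inner ℝ (W j) (X s)) ∂D
      - (n : ℝ)⁻¹ * ∑ i, ψ (inner ℝ (W j) (X (S i))))) := by
    simp only [hf]
    rw [integral_const_mul, integral_sub (hint j) (integrable_const _)]
    simp only [integral_const, probReal_univ, smul_eq_mul, one_mul, Finset.sum_sub_distrib,
      Finset.sum_const, Finset.card_univ, Fintype.card_fin, nsmul_eq_mul, ← Finset.mul_sum]
    field_simp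
    ring
  rw [e2]
  exact mul_le_mul_of_nonneg_left (mul_le_mul_of_nonneg_left h hc0) hn'.le

/-- The finite bound does not depend on the number of indices, so it passes to the increasing union
over a dense sequence of `T`. Both sides of the inequality are continuous in the weight, which
extends it from the sequence to `T`. -/
theorem exists_measurableSet_uniform_deviation [TopologicalSpace.SeparableSpace H] {n : ℕ}
    (hn : 0 < n) {X : Z → H} {R ρ t : ℝ}
    (hXm : ∀ W, Measurable fun s => (inner ℝ W (X s) : ℝ)) (hX : ∀ s, ‖X s‖ ≤ R)
    {ψ : ℝ → ℝ} (hψ : LipschitzWith 1 ψ) (T : Set H) (hT : ∀ W ∈ T, ‖W‖ ≤ ρ)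
    (hG : 0 < ρ * R) (ht : 0 ≤ t) :
    ∃ E : Set (Fin n → Z), MeasurableSet E ∧
      (Measure.pi fun _ : Fin n => D).real Eᶜ
        ≤ 2 * Real.exp (-(n * t ^ 2 / (8 * (ρ * R) ^ 2))) ∧
      ∀ S ∈ E, ∀ W ∈ T, ∫ s, ψ (inner ℝ W (X s)) ∂D
          ≤ (n : ℝ)⁻¹ * ∑ i, ψ (inner ℝ W (X (S i))) + t := by
  rcases T.eq_empty_or_nonempty with rfl | hne
  · exact ⟨Set.univ, MeasurableSet.univ, by simp; positivity, by simp⟩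
  have : Nonempty T := hne.to_subtype
  have : SecondCountableTopology H := UniformSpace.secondCountable_of_separable H
  set u := TopologicalSpace.denseSeq T
  set P := Measure.pi fun _ : Fin n => D
  have hψm : ∀ W : H, Measurable fun s => ψ (inner ℝ W (X s)) := fun W =>
    hψ.continuous.measurable.comp (hXm _)
  set bad : ℕ → Set (Fin n → Z) := fun m => {S | ∃ j ∈ Finset.range m,
    t ≤ ∫ s, ψ (inner ℝ (u j : H) (X s)) ∂D
      - (n : ℝ)⁻¹ * ∑ i, ψ (inner ℝ (u j : H) (X (S i)))} with hbad
  have hbad_le : ∀ m, P.real (bad m) ≤ 2 * Real.exp (-(n * t ^ 2 / (8 * (ρ * R) ^ 2))) := fun m =>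
    measureReal_exists_deviation_le D hn hXm hX hψ (Finset.range m) (fun j => (u j : H))
      (fun j => hT _ (u j).2) hG ht
  have hmono : Monotone bad := by
    rintro a b hab S ⟨j, hj, h⟩
    exact ⟨j, Finset.range_mono hab hj, h⟩
  have hbadm : ∀ m, MeasurableSet (bad m) := fun m => by
    have : bad m = ⋃ j ∈ Finset.range m, {S | t ≤ ∫ s, ψ (inner ℝ (u j : H) (X s)) ∂D
      - (n : ℝ)⁻¹ * ∑ i, ψ (inner ℝ (u j : H) (X (S i)))} := by
      ext S; simp [hbad]
    rw [this]
    refine Finset.measurableSet_biUnion _ fun j _ => measurableSet_le measurable_const ?_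
    refine measurable_const.sub (Measurable.const_mul (Finset.measurable_sum _ fun i _ => ?_) _)
    exact (hψm _).comp (measurable_pi_apply i)
  refine ⟨(⋃ m, bad m)ᶜ, (MeasurableSet.iUnion hbadm).compl, ?_, ?_⟩
  · rw [compl_compl, Measure.real, hmono.measure_iUnion]
    refine ENNReal.toReal_le_of_le_ofReal (by positivity) (iSup_le fun m => ?_)
    rw [ENNReal.le_ofReal_iff_toReal_le (measure_ne_top _ _) (by positivity)]
    exact hbad_le m
  · intro S hS W hW
    have hcl : IsClosed {V : T | ∫ s, ψ (inner ℝ (V : H) (X s)) ∂D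
        ≤ (n : ℝ)⁻¹ * ∑ i, ψ (inner ℝ (V : H) (X (S i))) + t} := by
      refine isClosed_le ?_ ?_
      · refine continuous_of_dominated (bound := fun _ => |ψ 0| + ρ * R)
          (fun V => (hψm _).aestronglyMeasurable)
          (fun V => Filter.Eventually.of_forall fun s => ?_) (integrable_const _)
          (Filter.Eventually.of_forall fun s => ?_)
        · have h1 := abs_lipschitz_inner_sub_le hψ (hT V V.2) (hX s)
          have h2 := abs_add_le (ψ 0) (ψ (inner ℝ (V : H) (X s)) - ψ 0)
          rw [add_sub_cancel] at h2
          rw [Real.norm_eq_abs]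
          linarith
        · exact hψ.continuous.comp (continuous_subtype_val.inner continuous_const)
      · refine (continuous_const.mul (continuous_finsetSum _ fun i _ => ?_)).add continuous_const
        exact hψ.continuous.comp (continuous_subtype_val.inner continuous_const)
    have hd : Set.range u ⊆ {V : T | ∫ s, ψ (inner ℝ (V : H) (X s)) ∂D
        ≤ (n : ℝ)⁻¹ * ∑ i, ψ (inner ℝ (V : H) (X (S i))) + t} := by
      rintro _ ⟨j, rfl⟩
      by_contra hj
      simp only [Set.mem_ofPred_eq, not_le] at hj
      exact hS (Set.mem_iUnion.2 ⟨j + 1, j, Finset.self_mem_range_succ j, by linarith⟩)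
    have huniv := hcl.closure_subset_iff.2 hd
    rw [(TopologicalSpace.denseRange_denseSeq T).closure_range] at huniv
    exact huniv (Set.mem_univ ⟨W, hW⟩)

end UniformDeviation

/-! ### Hölder's inequality and comparison with the Euclidean norm. -/

section VecNorm

variable {d : ℕ}

theorem vecNorm_eq_sum {p : ℝ≥0∞} (hp0 : p ≠ 0) (hp : p ≠ ∞) (x : Fin d → ℝ) :
    vecNorm p x = (∑ i, |x i| ^ p.toReal) ^ (1 / p.toReal) := by
  rw [vecNorm, PiLp.norm_eq_sum (ENNReal.toReal_pos hp0 hp)]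
  simp only [Real.norm_eq_abs]

theorem vecNorm_rpow_eq_sum {p : ℝ≥0∞} (hp0 : p ≠ 0) (hp : p ≠ ∞) (x : Fin d → ℝ) :
    vecNorm p x ^ p.toReal = ∑ i, |x i| ^ p.toReal := by
  have h := ENNReal.toReal_pos hp0 hp
  rw [vecNorm_eq_sum hp0 hp, ← Real.rpow_mul (Finset.sum_nonneg fun i _ => by positivity),
    one_div_mul_cancel h.ne', Real.rpow_one]

theorem vecNorm_nonneg {p : ℝ≥0∞} [Fact (1 ≤ p)] (x : Fin d → ℝ) : 0 ≤ vecNorm p x :=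
  norm_nonneg (WithLp.toLp p x : PiLp p (fun _ : Fin d => ℝ))

theorem vecNorm_add_le {p : ℝ≥0∞} [Fact (1 ≤ p)] (x y : Fin d → ℝ) :
    vecNorm p (x + y) ≤ vecNorm p x + vecNorm p y :=
  norm_add_le (WithLp.toLp p x : PiLp p (fun _ : Fin d => ℝ)) (WithLp.toLp p y)

theorem vecNorm_smul {p : ℝ≥0∞} [Fact (1 ≤ p)] (c : ℝ) (x : Fin d → ℝ) :
    vecNorm p (c • x) = |c| * vecNorm p x :=
  norm_smul c (WithLp.toLp p x : PiLp p (fun _ : Fin d => ℝ))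

theorem abs_apply_le_vecNorm {p : ℝ≥0∞} [Fact (1 ≤ p)] (x : Fin d → ℝ) (i : Fin d) :
    |x i| ≤ vecNorm p x :=
  PiLp.norm_apply_le (WithLp.toLp p x : PiLp p (fun _ : Fin d => ℝ)) i

theorem vecNorm_one (x : Fin d → ℝ) : vecNorm 1 x = ∑ i, |x i| := by
  rw [vecNorm, PiLp.norm_eq_of_L1]
  simp only [Real.norm_eq_abs]

theorem vecNorm_two_sq (x : Fin d → ℝ) : vecNorm 2 x ^ 2 = ∑ i, |x i| ^ 2 := by
  rw [vecNorm, PiLp.norm_sq_eq_of_L2]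
  simp only [Real.norm_eq_abs]

theorem abs_dotProduct_le_one_top (v x : Fin d → ℝ) :
    |v ⬝ᵥ x| ≤ vecNorm 1 v * vecNorm ∞ x := by
  rw [vecNorm_one, Finset.sum_mul, dotProduct]
  refine (Finset.abs_sum_le_sum_abs _ _).trans (Finset.sum_le_sum fun i _ => ?_)
  rw [abs_mul]
  exact mul_le_mul_of_nonneg_left (abs_apply_le_vecNorm x i) (abs_nonneg _)

/-- Hölder's inequality for the dot product. -/
theorem abs_dotProduct_le_vecNorm_mul {p q : ℝ≥0∞} (hpq : p⁻¹ + q⁻¹ = 1) (v x : Fin d → ℝ) :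
    |v ⬝ᵥ x| ≤ vecNorm q v * vecNorm p x := by
  by_cases hp : p = ∞
  · have hq : q = 1 := by simpa [hp] using hpq
    rw [hp, hq]
    exact abs_dotProduct_le_one_top v x
  by_cases hq : q = ∞
  · have hp' : p = 1 := by simpa [hq] using hpq
    rw [hp', hq, dotProduct_comm, mul_comm]
    exact abs_dotProduct_le_one_top x v
  have hp0 : p ≠ 0 := by rintro rfl; simp at hpq
  have hq0 : q ≠ 0 := by rintro rfl; simp at hpq
  have hc : q.toReal.HolderConjugate p.toReal := by
    have h1 := ENNReal.toReal_pos hp0 hp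
    have h2 := ENNReal.toReal_pos hq0 hq
    have h3 : p.toReal⁻¹ + q.toReal⁻¹ = 1 := by
      rw [← ENNReal.toReal_inv, ← ENNReal.toReal_inv,
        ← ENNReal.toReal_add (ENNReal.inv_ne_top.2 hp0) (ENNReal.inv_ne_top.2 hq0), hpq,
        ENNReal.toReal_one]
    refine ⟨by rw [add_comm, h3, inv_one], h2, h1⟩
  rw [vecNorm_eq_sum hp0 hp, vecNorm_eq_sum hq0 hq]
  have h := Real.inner_le_Lp_mul_Lq Finset.univ (fun i => |v i|) (fun i => |x i|) hc
  simp only [abs_abs] at h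
  refine le_trans ?_ h
  rw [dotProduct]
  refine (Finset.abs_sum_le_sum_abs _ _).trans_eq (Finset.sum_congr rfl fun i _ => abs_mul _ _)

theorem vecNorm_two_le_of_le_two {p : ℝ≥0∞} [h1 : Fact (1 ≤ p)] (hp : p ≤ 2) (x : Fin d → ℝ) :
    vecNorm 2 x ≤ vecNorm p x := by
  have hp0 : p ≠ 0 := (zero_lt_one.trans_le h1.out).ne'
  have hpt : p ≠ ∞ := ne_top_of_le_ne_top (by simp) hp
  have hpr : p.toReal ≤ 2 := by simpa using ENNReal.toReal_mono (by simp) hp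
  have hpr0 := ENNReal.toReal_pos hp0 hpt
  have hN := vecNorm_nonneg (p := p) x
  refine le_of_sq_le_sq ?_ hN
  -- In each summand the factor with exponent `2 - p` is bounded using `|x i| ≤ ‖x‖_p`; the
  -- remaining factors sum to `‖x‖_p ^ p`.
  have key : ∀ t : ℝ, 0 ≤ t → t ^ 2 = t ^ p.toReal * t ^ (2 - p.toReal) := fun t ht => by
    rw [← Real.rpow_add_of_nonneg ht hpr0.le (by linarith), add_sub_cancel]
    norm_cast
  rw [vecNorm_two_sq, key _ hN, vecNorm_rpow_eq_sum hp0 hpt, Finset.sum_mul]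
  refine Finset.sum_le_sum fun i _ => ?_
  rw [key _ (abs_nonneg _)]
  refine mul_le_mul_of_nonneg_left ?_ (by positivity)
  exact Real.rpow_le_rpow (abs_nonneg _) (abs_apply_le_vecNorm x i) (by linarith)

theorem vecNorm_two_le_of_two_le {p : ℝ≥0∞} [h1 : Fact (1 ≤ p)] (hp : 2 ≤ p) (x : Fin d → ℝ) :
    vecNorm 2 x ≤ (d : ℝ) ^ (1 / 2 - (p⁻¹).toReal) * vecNorm p x := by
  have hN := vecNorm_nonneg (p := p) x
  have h2 := vecNorm_nonneg (p := 2) x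
  by_cases hpt : p = ∞
  · subst hpt
    refine le_of_sq_le_sq ?_ (by positivity)
    have e : ((d : ℝ) ^ (1 / 2 - ((∞ : ℝ≥0∞)⁻¹).toReal)) ^ 2 = d := by
      rw [← Real.rpow_natCast, ← Real.rpow_mul (by positivity)]
      norm_num
    rw [mul_pow, e, vecNorm_two_sq]
    calc ∑ i, |x i| ^ 2 ≤ ∑ _i : Fin d, vecNorm ∞ x ^ 2 := Finset.sum_le_sum fun i _ =>
          pow_le_pow_left₀ (abs_nonneg _) (abs_apply_le_vecNorm x i) 2
      _ = _ := by simp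
  have hp0 : p ≠ 0 := (zero_lt_one.trans_le h1.out).ne'
  have hpr : 2 ≤ p.toReal := by simpa using ENNReal.toReal_mono hpt hp
  -- Power mean inequality with exponent `p / 2 ≥ 1`, applied to the squares of the coordinates.
  have h := Real.rpow_sum_le_const_mul_sum_rpow (Finset.univ : Finset (Fin d))
    (fun i => |x i| ^ 2) (p := p.toReal / 2) (by linarith)
  have e1 : ∑ i, |(|x i| ^ 2)| = vecNorm 2 x ^ 2 := by
    rw [vecNorm_two_sq]
    exact Finset.sum_congr rfl fun i _ => abs_of_nonneg (by positivity)
  have e2 : ∑ i, |(|x i| ^ 2)| ^ (p.toReal / 2) = vecNorm p x ^ p.toReal := by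
    rw [vecNorm_rpow_eq_sum hp0 hpt]
    refine Finset.sum_congr rfl fun i _ => ?_
    rw [abs_of_nonneg (by positivity), ← Real.rpow_natCast, ← Real.rpow_mul (abs_nonneg _)]
    congr 1
    push_cast
    ring
  have e3 : (vecNorm 2 x ^ 2) ^ (p.toReal / 2) = vecNorm 2 x ^ p.toReal := by
    rw [← Real.rpow_natCast, ← Real.rpow_mul h2]
    congr 1
    push_cast
    ring
  have e4 : ((d : ℝ) ^ (1 / 2 - (p⁻¹).toReal)) ^ p.toReal = (d : ℝ) ^ (p.toReal / 2 - 1) := by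
    rw [← Real.rpow_mul (by positivity), ENNReal.toReal_inv]
    congr 1
    field_simp
  rw [e1, e2, e3, Finset.card_univ, Fintype.card_fin, ← e4,
    ← Real.mul_rpow (by positivity) hN] at h
  exact (Real.rpow_le_rpow_iff h2 (by positivity) (by linarith)).1 h

end VecNorm

/-! ### The dual norm and the worst-case margin. -/

section DualNorm

variable {d : ℕ} {p : ℝ≥0∞} [Fact (1 ≤ p)]

/-- Compactness of the unit ball supplies a maximizer, so the equality case of Hölder is not needed;
only the bound of the dual norm by the `ℓ_q` norm is used later. -/
theorem exists_isMaxOn_dotProduct (w : Fin d → ℝ) :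
    ∃ N : ℝ, 0 ≤ N ∧ (∀ x, w ⬝ᵥ x ≤ N * vecNorm p x) ∧ ∃ x, vecNorm p x ≤ 1 ∧ w ⬝ᵥ x = N := by
  have hcont : Continuous fun x : PiLp p (fun _ : Fin d => ℝ) => w ⬝ᵥ WithLp.ofLp x := by
    unfold dotProduct
    fun_prop
  obtain ⟨x, hx, hmax⟩ := (isCompact_closedBall (0 : PiLp p (fun _ : Fin d => ℝ)) 1).exists_isMaxOn
    ⟨0, by simp⟩ hcont.continuousOn
  have h0 : 0 ≤ w ⬝ᵥ WithLp.ofLp x := by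
    simpa using hmax (a := 0) (by simp)
  refine ⟨w ⬝ᵥ WithLp.ofLp x, h0, fun y => ?_, WithLp.ofLp x, by simpa [vecNorm] using hx, rfl⟩
  rcases (vecNorm_nonneg (p := p) y).eq_or_lt with hy | hy
  · have : y = 0 := by
      funext i
      have := abs_apply_le_vecNorm (p := p) y i
      rw [← hy] at this
      simpa using this
    rw [← hy, mul_zero, this, dotProduct_zero]
  · have h1 : vecNorm p ((vecNorm p y)⁻¹ • y) ≤ 1 := by
      rw [vecNorm_smul, abs_of_pos (inv_pos.2 hy), inv_mul_cancel₀ hy.ne']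
    have h2 := hmax (a := WithLp.toLp p ((vecNorm p y)⁻¹ • y)) (by simpa [vecNorm] using h1)
    simp only [Set.mem_ofPred_eq, dotProduct_smul, smul_eq_mul] at h2
    rwa [inv_mul_eq_div, div_le_iff₀ hy] at h2

variable (p) in
/-- The norm dual to `vecNorm p`. -/
noncomputable def dualNorm (w : Fin d → ℝ) : ℝ := (exists_isMaxOn_dotProduct (p := p) w).choose

theorem dualNorm_nonneg (w : Fin d → ℝ) : 0 ≤ dualNorm p w :=
  (exists_isMaxOn_dotProduct (p := p) w).choose_spec.1

theorem abs_dotProduct_le_dualNorm (w x : Fin d → ℝ) : |w ⬝ᵥ x| ≤ dualNorm p w * vecNorm p x := by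
  have h := (exists_isMaxOn_dotProduct (p := p) w).choose_spec.2.1
  refine abs_le.2 ⟨?_, h x⟩
  have h1 := h (-x)
  have e : vecNorm p (-x) = vecNorm p x := by
    have := vecNorm_smul (p := p) (-1) x
    simpa using this
  rw [e, dotProduct_neg] at h1
  change -(w ⬝ᵥ x) ≤ dualNorm p w * vecNorm p x at h1
  linarith

theorem exists_dotProduct_eq_dualNorm (w : Fin d → ℝ) :
    ∃ x, vecNorm p x ≤ 1 ∧ w ⬝ᵥ x = dualNorm p w :=
  (exists_isMaxOn_dotProduct (p := p) w).choose_spec.2.2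

theorem dualNorm_le_of_forall {w : Fin d → ℝ} {C : ℝ} (hC : 0 ≤ C)
    (h : ∀ x, w ⬝ᵥ x ≤ C * vecNorm p x) : dualNorm p w ≤ C := by
  obtain ⟨x, hx, e⟩ := exists_dotProduct_eq_dualNorm (p := p) w
  rw [← e]
  exact (h x).trans (mul_le_of_le_one_right hC hx)

/-- The smallest value of `y * (w ⬝ᵥ ·)` on an `ℓ_p` ball is attained. -/
theorem exists_mul_dotProduct_eq {r y : ℝ} (hr : 0 ≤ r) (hy : y = 1 ∨ y = -1) (w x : Fin d → ℝ) :
    ∃ δ, vecNorm p δ ≤ r ∧ y * (w ⬝ᵥ (x + δ)) = y * (w ⬝ᵥ x) - r * dualNorm p w := by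
  obtain ⟨u, hu, e⟩ := exists_dotProduct_eq_dualNorm (p := p) w
  refine ⟨(-(y * r)) • u, ?_, ?_⟩
  · rw [vecNorm_smul, abs_neg, abs_mul, abs_of_nonneg hr]
    have : |y| = 1 := by rcases hy with rfl | rfl <;> simp
    rw [this, one_mul]
    exact mul_le_of_le_one_right hr hu
  · rw [dotProduct_add, dotProduct_smul, e, smul_eq_mul]
    have : y * y = 1 := by rcases hy with rfl | rfl <;> simp
    linear_combination (-r * dualNorm p w) * this

theorem sub_dualNorm_le {r y : ℝ} (hy : y = 1 ∨ y = -1) (w x δ : Fin d → ℝ)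
    (hδ : vecNorm p δ ≤ r) : y * (w ⬝ᵥ x) - r * dualNorm p w ≤ y * (w ⬝ᵥ (x + δ)) := by
  have h := abs_le.1 ((abs_dotProduct_le_dualNorm (p := p) w δ).trans
    (mul_le_mul_of_nonneg_left hδ (dualNorm_nonneg w)))
  rw [dotProduct_add]
  rcases hy with rfl | rfl <;> linarith

end DualNorm

/-! ### The dual norm against the Euclidean norm. -/

section EuclideanComparison

variable {d : ℕ}

theorem abs_dotProduct_le_vecNorm_two (w x : Fin d → ℝ) :
    |w ⬝ᵥ x| ≤ vecNorm 2 w * vecNorm 2 x :=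
  abs_dotProduct_le_vecNorm_mul (p := 2) (q := 2) ENNReal.inv_two_add_inv_two w x

theorem dualNorm_le_mul_vecNorm_two {p : ℝ≥0∞} [Fact (1 ≤ p)] {M : ℝ} (hM0 : 0 ≤ M)
    (hM : ∀ x : Fin d → ℝ, vecNorm 2 x ≤ M * vecNorm p x) (w : Fin d → ℝ) :
    dualNorm p w ≤ M * vecNorm 2 w := by
  have hw := vecNorm_nonneg (p := 2) w
  refine dualNorm_le_of_forall (by positivity) fun x => ?_
  refine (le_abs_self _).trans ((abs_dotProduct_le_vecNorm_two w x).trans ?_)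
  calc vecNorm 2 w * vecNorm 2 x ≤ vecNorm 2 w * (M * vecNorm p x) :=
        mul_le_mul_of_nonneg_left (hM x) hw
    _ = _ := by ring

end EuclideanComparison

/-! ### Convergence of adversarial training on the sample. -/

section Optimization

variable {d n : ℕ} {p : ℝ≥0∞} [Fact (1 ≤ p)]

variable (p) in
/-- The empirical adversarial loss of the halfspace `w`. -/
noncomputable def advRisk (ℓ : ℝ → ℝ) (r : ℝ) (S : Fin n → (Fin d → ℝ) × ℝ) (w : Fin d → ℝ) : ℝ :=
  (n : ℝ)⁻¹ * ∑ i, ℓ ((S i).2 * (w ⬝ᵥ (S i).1) - r * dualNorm p w)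

theorem vecNorm_two_sq_eq_dotProduct (x : Fin d → ℝ) : vecNorm 2 x ^ 2 = x ⬝ᵥ x := by
  rw [vecNorm_two_sq, dotProduct]
  exact Finset.sum_congr rfl fun i _ => by rw [sq_abs, sq]

theorem vecNorm_sum_le {ι : Type*} (s : Finset ι) (f : ι → Fin d → ℝ) :
    vecNorm p (∑ i ∈ s, f i) ≤ ∑ i ∈ s, vecNorm p (f i) := by
  have h := norm_sum_le s fun i => (WithLp.toLp p (f i) : PiLp p (fun _ : Fin d => ℝ))
  rwa [← WithLp.toLp_sum] at h

theorem IsSubgradient.abs_le_one {ℓ : ℝ → ℝ} (hL : LipschitzWith 1 ℓ) {a g : ℝ}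
    (h : IsSubgradient ℓ a g) : |g| ≤ 1 := by
  have hd : ∀ u v, |ℓ u - ℓ v| ≤ |u - v| := fun u v => by
    simpa [Real.dist_eq] using hL.dist_le_mul u v
  have h1 := h (a + 1)
  have h2 := h (a - 1)
  have h3 := abs_le.1 (hd (a + 1) a)
  have h4 := abs_le.1 (hd (a - 1) a)
  norm_num at h1 h2 h3 h4
  exact abs_le.2 ⟨by linarith, by linarith⟩

/-- One step of adversarial training decreases the distance to `V` when `V` has a smaller
adversarial loss. -/
theorem vecNorm_advStep_sub_sq_le {ℓ : ℝ → ℝ} (hℓd : Antitone ℓ) (hℓL : LipschitzWith 1 ℓ)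
    (hn : 0 < n) {r η M : ℝ} (hr : 0 ≤ r) (hη : 0 ≤ η) (hM0 : 0 ≤ M)
    (hM : ∀ x : Fin d → ℝ, vecNorm 2 x ≤ M * vecNorm p x)
    {S : Fin n → (Fin d → ℝ) × ℝ} (hS : ∀ i, vecNorm p (S i).1 ≤ 1 ∧ ((S i).2 = 1 ∨ (S i).2 = -1))
    (V w : Fin d → ℝ) {δ : Fin n → Fin d → ℝ} {g : Fin n → ℝ}
    (hδ : ∀ i, vecNorm p (δ i) ≤ r ∧
      ∀ δ' : Fin d → ℝ, vecNorm p δ' ≤ r →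
        ℓ ((S i).2 * (w ⬝ᵥ ((S i).1 + δ'))) ≤ ℓ ((S i).2 * (w ⬝ᵥ ((S i).1 + δ i))))
    (hg : ∀ i, IsSubgradient ℓ ((S i).2 * (w ⬝ᵥ ((S i).1 + δ i))) (g i)) :
    vecNorm 2 (w - (η / n) • ∑ i, (g i * (S i).2) • ((S i).1 + δ i) - V) ^ 2
      ≤ vecNorm 2 (w - V) ^ 2 - 2 * η * (advRisk p ℓ r S w - advRisk p ℓ r S V)
        + η ^ 2 * (M * (1 + r)) ^ 2 := by
  have hn' : (0 : ℝ) < n := by exact_mod_cast hn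
  set G := ∑ i, (g i * (S i).2) • ((S i).1 + δ i) with hG
  have hnorm : vecNorm 2 G ≤ n * (M * (1 + r)) := by
    calc vecNorm 2 G ≤ ∑ i, vecNorm 2 ((g i * (S i).2) • ((S i).1 + δ i)) := vecNorm_sum_le _ _
      _ ≤ ∑ _i : Fin n, M * (1 + r) := by
          refine Finset.sum_le_sum fun i _ => ?_
          have h1 : |g i * (S i).2| ≤ 1 := by
            rw [abs_mul]
            have h2 := (hg i).abs_le_one hℓL
            rcases (hS i).2 with h | h <;> simpa [h] using h2
          rw [vecNorm_smul]
          refine (mul_le_of_le_one_left (vecNorm_nonneg _) h1).trans ((hM _).trans ?_)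
          refine mul_le_mul_of_nonneg_left ((vecNorm_add_le _ _).trans ?_) hM0
          exact add_le_add (hS i).1 (hδ i).1
      _ = _ := by simp
  -- The subgradient inequality holds with the perturbations frozen. Freezing attains the worst-case
  -- loss of `w`, because `δ i` is a maximizer, and can only underestimate that of `V`.
  have hinner : n * (advRisk p ℓ r S w - advRisk p ℓ r S V) ≤ G ⬝ᵥ (w - V) := by
    have e : n * (advRisk p ℓ r S w - advRisk p ℓ r S V)
        = ∑ i, (ℓ ((S i).2 * (w ⬝ᵥ (S i).1) - r * dualNorm p w)
          - ℓ ((S i).2 * (V ⬝ᵥ (S i).1) - r * dualNorm p V)) := by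
      rw [advRisk, advRisk, ← mul_sub, mul_inv_cancel_left₀ hn'.ne', Finset.sum_sub_distrib]
    rw [e, hG, sum_dotProduct]
    refine Finset.sum_le_sum fun i _ => ?_
    obtain ⟨u, hu, eu⟩ := exists_mul_dotProduct_eq (p := p) hr (hS i).2 w (S i).1
    have h1 := (hδ i).2 u hu
    rw [eu] at h1
    have h2 := hg i ((S i).2 * (V ⬝ᵥ ((S i).1 + δ i)))
    have h3 := hℓd (sub_dualNorm_le (hS i).2 V (S i).1 (δ i) (hδ i).1)
    rw [smul_dotProduct, dotProduct_sub, dotProduct_comm _ w, dotProduct_comm _ V, smul_eq_mul]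
    linarith
  have hexp : vecNorm 2 (w - (η / n) • G - V) ^ 2
      = vecNorm 2 (w - V) ^ 2 - 2 * (η / n) * (G ⬝ᵥ (w - V)) + (η / n) ^ 2 * vecNorm 2 G ^ 2 := by
    have e : w - (η / n) • G - V = (w - V) - (η / n) • G := by abel
    rw [e]
    simp only [vecNorm_two_sq_eq_dotProduct]
    generalize w - V = u
    simp only [sub_dotProduct, dotProduct_sub, smul_dotProduct, dotProduct_smul, smul_eq_mul]
    rw [dotProduct_comm u G]
    ring
  rw [hexp]
  have h1 : (η / n) ^ 2 * vecNorm 2 G ^ 2 ≤ η ^ 2 * (M * (1 + r)) ^ 2 := by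
    rw [← mul_pow, ← mul_pow]
    refine pow_le_pow_left₀ (mul_nonneg (by positivity) (vecNorm_nonneg _)) ?_ 2
    calc η / n * vecNorm 2 G ≤ η / n * (n * (M * (1 + r))) :=
          mul_le_mul_of_nonneg_left hnorm (by positivity)
      _ = _ := by field_simp
  have h2 : 2 * η * (advRisk p ℓ r S w - advRisk p ℓ r S V) ≤ 2 * (η / n) * (G ⬝ᵥ (w - V)) := by
    calc 2 * η * (advRisk p ℓ r S w - advRisk p ℓ r S V)
        = 2 * (η / n) * (n * (advRisk p ℓ r S w - advRisk p ℓ r S V)) := by field_simp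
      _ ≤ _ := mul_le_mul_of_nonneg_left hinner (by positivity)
  linarith

/-- The worst perturbation for `w` is also admissible for `V`, so the losses can be compared at one
common point. -/
theorem advRisk_sub_le {ℓ : ℝ → ℝ} (hℓd : Antitone ℓ) (hℓL : LipschitzWith 1 ℓ) (hn : 0 < n)
    {r M : ℝ} (hr : 0 ≤ r) (hM0 : 0 ≤ M)
    (hM : ∀ x : Fin d → ℝ, vecNorm 2 x ≤ M * vecNorm p x)
    {S : Fin n → (Fin d → ℝ) × ℝ} (hS : ∀ i, vecNorm p (S i).1 ≤ 1 ∧ ((S i).2 = 1 ∨ (S i).2 = -1))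
    (V w : Fin d → ℝ) :
    advRisk p ℓ r S w - advRisk p ℓ r S V ≤ M * (1 + r) * vecNorm 2 (w - V) := by
  have hn' : (0 : ℝ) < n := by exact_mod_cast hn
  rw [advRisk, advRisk, ← mul_sub, ← Finset.sum_sub_distrib, inv_mul_le_iff₀ hn']
  calc _ ≤ ∑ _i : Fin n, M * (1 + r) * vecNorm 2 (w - V) := Finset.sum_le_sum fun i _ => ?_
    _ = _ := by simp
  obtain ⟨u, hu, eu⟩ := exists_mul_dotProduct_eq (p := p) hr (hS i).2 w (S i).1
  have h3 := hℓd (sub_dualNorm_le (hS i).2 V (S i).1 u hu)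
  rw [← eu]
  have h4 : |ℓ ((S i).2 * (w ⬝ᵥ ((S i).1 + u))) - ℓ ((S i).2 * (V ⬝ᵥ ((S i).1 + u)))|
      ≤ |(S i).2 * (w ⬝ᵥ ((S i).1 + u)) - (S i).2 * (V ⬝ᵥ ((S i).1 + u))| := by
    simpa [Real.dist_eq] using
      hℓL.dist_le_mul ((S i).2 * (w ⬝ᵥ ((S i).1 + u))) ((S i).2 * (V ⬝ᵥ ((S i).1 + u)))
  have h5 : |(S i).2 * (w ⬝ᵥ ((S i).1 + u)) - (S i).2 * (V ⬝ᵥ ((S i).1 + u))|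
      = |(w - V) ⬝ᵥ ((S i).1 + u)| := by
    rw [← mul_sub, ← sub_dotProduct, abs_mul]
    rcases (hS i).2 with h | h <;> simp [h]
  have h6 : |(w - V) ⬝ᵥ ((S i).1 + u)| ≤ M * (1 + r) * vecNorm 2 (w - V) := by
    refine (abs_dotProduct_le_vecNorm_two _ _).trans ?_
    rw [mul_comm]
    refine mul_le_mul_of_nonneg_right ((hM _).trans ?_) (vecNorm_nonneg _)
    refine mul_le_mul_of_nonneg_left ((vecNorm_add_le _ _).trans ?_) hM0
    exact add_le_add (hS i).1 hu
  have h7 := le_abs_self (ℓ ((S i).2 * (w ⬝ᵥ ((S i).1 + u))) - ℓ ((S i).2 * (V ⬝ᵥ ((S i).1 + u))))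
  linarith

/-- Adversarial training finds an iterate whose adversarial loss is at most that of `V` plus `ε`
and whose Euclidean norm is at most twice that of `V`. -/
theorem IsAdvTraining.exists_advRisk_le {ℓ : ℝ → ℝ} (hℓd : Antitone ℓ) (hℓL : LipschitzWith 1 ℓ)
    (hn : 0 < n) {r η M H ε : ℝ} (hr : 0 ≤ r) (hη : 0 < η) (hM0 : 0 ≤ M) (hε : 0 < ε)
    (hM : ∀ x : Fin d → ℝ, vecNorm 2 x ≤ M * vecNorm p x)
    (hH0 : 0 < H) (hH : (M * (1 + r)) ^ 2 ≤ H) (hηε : η ≤ ε * H⁻¹ / 4)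
    {S : Fin n → (Fin d → ℝ) × ℝ} (hS : ∀ i, vecNorm p (S i).1 ≤ 1 ∧ ((S i).2 = 1 ∨ (S i).2 = -1))
    (V : Fin d → ℝ) {N : ℕ} (hV : vecNorm 2 V ^ 2 ≤ η * ε * (N + 1)) {w : ℕ → Fin d → ℝ}
    (hw0 : w 0 = 0) (hw : IsAdvTraining ℓ p r η S N w) :
    ∃ k ≤ N, advRisk p ℓ r S (w k) ≤ advRisk p ℓ r S V + ε ∧
      vecNorm 2 (w k) ≤ 2 * vecNorm 2 V := by
  classical
  have hηH : η * H ≤ ε / 4 := by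
    calc η * H ≤ ε * H⁻¹ / 4 * H := mul_le_mul_of_nonneg_right hηε hH0.le
      _ = _ := by field_simp
  have hneg : ∀ x : Fin d → ℝ, vecNorm 2 (-x) = vecNorm 2 x := fun x => by
    have := vecNorm_smul (p := 2) (-1) x
    simpa using this
  have h0 : vecNorm 2 (w 0 - V) = vecNorm 2 V := by rw [hw0, zero_sub, hneg]
  -- Each failing step gains `2 η ε` and loses at most `η² H ≤ η ε / 4`.
  have hdec : ∀ k ≤ N, (∀ j < k, advRisk p ℓ r S V + ε < advRisk p ℓ r S (w j)) →
      vecNorm 2 (w k - V) ^ 2 ≤ vecNorm 2 V ^ 2 - η * ε * k := by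
    intro k
    induction k with
    | zero => intro _ _; rw [h0]; simp
    | succ k ih =>
      intro hk hj
      have h1 := ih (by omega) fun j hjk => hj j (by omega)
      obtain ⟨δ, g, hδ, hg, e⟩ := hw k (by omega)
      have h2 := vecNorm_advStep_sub_sq_le hℓd hℓL hn hr hη.le hM0 hM hS V (w k) hδ hg
      rw [← e] at h2
      have h3 := hj k (by omega)
      have h4 : η ^ 2 * (M * (1 + r)) ^ 2 ≤ η * (ε / 4) := by
        rw [sq η, mul_assoc]
        refine mul_le_mul_of_nonneg_left (le_trans ?_ hηH) hη.le
        exact mul_le_mul_of_nonneg_left hH hη.le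
      have h5 : η * ε ≤ η * (advRisk p ℓ r S (w k) - advRisk p ℓ r S V) :=
        mul_le_mul_of_nonneg_left (by linarith) hη.le
      have h6 : 0 < η * ε := mul_pos hη hε
      push_cast
      linarith
  -- The budget covers `N + 1` decrements but only `N` steps are made. The last iterate is then
  -- within `√(η ε)` of `V`, and the Lipschitz bound gives `ε² < H η ε ≤ ε² / 4`, a contradiction.
  have hex : ∃ k, k ≤ N ∧ advRisk p ℓ r S (w k) ≤ advRisk p ℓ r S V + ε := by
    by_contra! hcon
    have h1 := hdec N le_rfl fun j hj => hcon j hj.le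
    have h2 := hcon N le_rfl
    have h3 := advRisk_sub_le hℓd hℓL hn hr hM0 hM hS V (w N)
    have h4 : ε ^ 2 < H * vecNorm 2 (w N - V) ^ 2 := by
      calc ε ^ 2 < (M * (1 + r) * vecNorm 2 (w N - V)) ^ 2 :=
            pow_lt_pow_left₀ (by linarith) hε.le two_ne_zero
        _ = (M * (1 + r)) ^ 2 * vecNorm 2 (w N - V) ^ 2 := by ring
        _ ≤ _ := mul_le_mul_of_nonneg_right hH (by positivity)
    have h5 : H * vecNorm 2 (w N - V) ^ 2 ≤ H * (η * ε) :=
      mul_le_mul_of_nonneg_left (by linarith) hH0.le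
    nlinarith
  -- The first successful iterate is taken: every earlier step decreased the distance to `V`, so it
  -- is still at most `‖V‖_2`.
  have hk := Nat.find_spec hex
  refine ⟨Nat.find hex, hk.1, hk.2, ?_⟩
  have h1 := hdec _ hk.1 fun j hj => by
    have := Nat.find_min hex hj
    push Not at this
    exact this (hj.le.trans hk.1)
  have h2 : vecNorm 2 (w (Nat.find hex) - V) ≤ vecNorm 2 V := by
    refine le_of_sq_le_sq ?_ (vecNorm_nonneg _)
    have : 0 ≤ η * ε * (Nat.find hex : ℕ) := by positivity
    linarith
  have h3 := vecNorm_add_le (p := 2) (w (Nat.find hex) - V) V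
  rw [sub_add_cancel] at h3
  linarith

end Optimization

/-! ### Population loss, robust error and uniform concentration. -/

section PopulationRisk

variable {d : ℕ} {p : ℝ≥0∞} [Fact (1 ≤ p)]

theorem continuous_vecNorm : Continuous fun x : Fin d → ℝ => vecNorm p x :=
  (PiLp.continuous_toLp p (fun _ : Fin d => ℝ)).norm

theorem measurable_mul_dotProduct (w : Fin d → ℝ) :
    Measurable fun s : (Fin d → ℝ) × ℝ => s.2 * (w ⬝ᵥ s.1) := by
  unfold dotProduct
  fun_prop

variable (p d) in
/-- The labelled examples with instance in the unit ball and label `±1`. -/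
def goodExamples : Set ((Fin d → ℝ) × ℝ) := {s | vecNorm p s.1 ≤ 1 ∧ (s.2 = 1 ∨ s.2 = -1)}

theorem measurableSet_goodExamples : MeasurableSet (goodExamples d p) := by
  have h1 : MeasurableSet {s : (Fin d → ℝ) × ℝ | vecNorm p s.1 ≤ 1} :=
    measurableSet_le (continuous_vecNorm.measurable.comp measurable_fst) measurable_const
  have h2 : MeasurableSet {s : (Fin d → ℝ) × ℝ | s.2 = 1} :=
    measurableSet_eq_fun measurable_snd measurable_const
  have h3 : MeasurableSet {s : (Fin d → ℝ) × ℝ | s.2 = -1} :=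
    measurableSet_eq_fun measurable_snd measurable_const
  exact h1.inter (h2.union h3)

variable {D : Measure ((Fin d → ℝ) × ℝ)} [IsProbabilityMeasure D]

theorem integrable_advLoss {ψ : ℝ → ℝ} (hψ : LipschitzWith 1 ψ)
    (hD : ∀ᵐ s ∂D, s ∈ goodExamples d p) (r : ℝ) (w : Fin d → ℝ) :
    Integrable (fun s => ψ (s.2 * (w ⬝ᵥ s.1) - r * dualNorm p w)) D := by
  refine Integrable.of_bound (C := |ψ 0| + (dualNorm p w + |r * dualNorm p w|)) ?_ ?_
  · exact (hψ.continuous.measurable.comp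
      ((measurable_mul_dotProduct w).sub_const _)).aestronglyMeasurable
  · filter_upwards [hD] with s hs
    set m := s.2 * (w ⬝ᵥ s.1) - r * dualNorm p w with hm
    have h1 : |ψ m - ψ 0| ≤ |m - 0| := by
      simpa [Real.dist_eq] using hψ.dist_le_mul m 0
    have h2 : |s.2 * (w ⬝ᵥ s.1)| ≤ dualNorm p w := by
      have h3 : |w ⬝ᵥ s.1| ≤ dualNorm p w := (abs_dotProduct_le_dualNorm (p := p) w s.1).trans
        (mul_le_of_le_one_right (dualNorm_nonneg w) hs.1)
      rw [abs_mul]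
      rcases hs.2 with h | h <;> simpa [h] using h3
    have h4 : |m - 0| ≤ dualNorm p w + |r * dualNorm p w| := by
      rw [sub_zero, hm]
      exact (abs_sub _ _).trans (add_le_add h2 le_rfl)
    have h5 := abs_add_le (ψ 0) (ψ m - ψ 0)
    rw [add_sub_cancel] at h5
    rw [Real.norm_eq_abs]
    linarith

/-- Markov's inequality: a robust mistake forces a worst-case margin at most 0, hence a loss at
least `ℓ 0`. -/
theorem mul_robustErr_le_integral {ℓ : ℝ → ℝ} (hℓ0 : ∀ t, 0 ≤ ℓ t) (hℓd : Antitone ℓ)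
    (hℓL : LipschitzWith 1 ℓ) (hD : ∀ᵐ s ∂D, s ∈ goodExamples d p) (r : ℝ) (w : Fin d → ℝ) :
    ℓ 0 * robustErr D p r w ≤ ∫ s, ℓ (s.2 * (w ⬝ᵥ s.1) - r * dualNorm p w) ∂D := by
  refine le_trans (mul_le_mul_of_nonneg_left ?_ (hℓ0 0)) (mul_meas_ge_le_integral_of_nonneg
    (Filter.Eventually.of_forall fun s => hℓ0 _) (integrable_advLoss hℓL hD r w) (ℓ 0))
  rw [robustErr]
  refine ENNReal.toReal_mono (measure_ne_top _ _) (measure_mono_ae ?_)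
  filter_upwards [hD] with s hs h
  obtain ⟨x', hx', hne⟩ := h
  refine hℓd ?_
  have hδ : vecNorm p (x' - s.1) ≤ r := by
    have := vecNorm_smul (p := p) (-1) (s.1 - x')
    simp only [neg_smul, one_smul, neg_sub, abs_neg, abs_one, one_mul] at this
    rwa [this]
  have h1 := sub_dualNorm_le (p := p) hs.2 w s.1 (x' - s.1) hδ
  rw [add_sub_cancel] at h1
  refine h1.trans ?_
  unfold sgn at hne
  split_ifs at hne with h0
  · rcases hs.2 with h | h
    · exact absurd h hne
    · rw [h]; linarith
  · rcases hs.2 with h | h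
    · rw [h]; linarith
    · exact absurd h hne

theorem dualNorm_smul_le {c : ℝ} (hc : 0 ≤ c) (v : Fin d → ℝ) :
    dualNorm p (c • v) ≤ c * dualNorm p v := by
  refine dualNorm_le_of_forall (mul_nonneg hc (dualNorm_nonneg v)) fun x => ?_
  rw [smul_dotProduct, smul_eq_mul, mul_assoc]
  exact mul_le_mul_of_nonneg_left
    ((le_abs_self _).trans (abs_dotProduct_le_dualNorm v x)) hc

/-- The adversarial loss of a rescaled unit vector in terms of its robust error and of the mass
near its hyperplane. -/
theorem integral_advLoss_smul_le {ℓ : ℝ → ℝ} (hℓ0 : ∀ t, 0 ≤ ℓ t) (hℓd : Antitone ℓ)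
    (hℓL : LipschitzWith 1 ℓ) (hD : ∀ᵐ s ∂D, s ∈ goodExamples d p) {r γ c : ℝ} (hr : 0 ≤ r)
    (hc : 0 ≤ c) {v : Fin d → ℝ} (hv : dualNorm p v ≤ 1) :
    ∫ s, ℓ (s.2 * ((c • v) ⬝ᵥ s.1) - r * dualNorm p (c • v)) ∂D
      ≤ (ℓ 0 + (1 + r) * c) * robustErr D p r v + ℓ 0 * D.real {s | |v ⬝ᵥ s.1| ≤ r + γ}
        + ℓ (c * γ) := by
  set E := {s : (Fin d → ℝ) × ℝ | ∃ x' : Fin d → ℝ, vecNorm p (s.1 - x') ≤ r ∧ s.2 ≠ sgn (v ⬝ᵥ x')}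
    with hE
  -- The mistake event is a projection over all perturbations; its measurable hull has the same mass
  -- and can carry an indicator.
  set A := toMeasurable D E with hA
  set F := {s : (Fin d → ℝ) × ℝ | |v ⬝ᵥ s.1| ≤ r + γ} with hF
  have hAm : MeasurableSet A := measurableSet_toMeasurable D E
  have hFm : MeasurableSet F := by
    refine measurableSet_le ?_ measurable_const
    unfold dotProduct
    fun_prop
  have hAE : D.real A = robustErr D p r v := by
    rw [robustErr, Measure.real, hA, measure_toMeasurable]; rfl
  have hcoef : 0 ≤ (1 + r) * c := by positivity
  have hpt : ∀ᵐ s ∂D, ℓ (s.2 * ((c • v) ⬝ᵥ s.1) - r * dualNorm p (c • v))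
      ≤ A.indicator (fun _ => ℓ 0 + (1 + r) * c) s + F.indicator (fun _ => ℓ 0) s + ℓ (c * γ) := by
    filter_upwards [hD] with s hs
    have i1 : 0 ≤ A.indicator (fun _ => ℓ 0 + (1 + r) * c) s :=
      Set.indicator_nonneg (fun _ _ => add_nonneg (hℓ0 0) hcoef) s
    have i2 : 0 ≤ F.indicator (fun _ => ℓ 0) s := Set.indicator_nonneg (fun _ _ => hℓ0 0) s
    have i3 := hℓ0 (c * γ)
    have hm : c * (s.2 * (v ⬝ᵥ s.1) - r * dualNorm p v)
        ≤ s.2 * ((c • v) ⬝ᵥ s.1) - r * dualNorm p (c • v) := by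
      have := mul_le_mul_of_nonneg_left (dualNorm_smul_le (p := p) hc v) hr
      rw [smul_dotProduct, smul_eq_mul]
      linarith
    have hrv : r * dualNorm p v ≤ r := mul_le_of_le_one_right hr hv
    -- On `A` the margin is at least `-(1 + r) c` and the Lipschitz bound applies. Off `A` it is
    -- nonnegative, and off both `A` and `F` it is at least `c γ`.
    by_cases hsA : s ∈ A
    · rw [Set.indicator_of_mem hsA]
      have h1 : |v ⬝ᵥ s.1| ≤ 1 := (abs_dotProduct_le_dualNorm (p := p) v s.1).trans
        (mul_le_one₀ hv (vecNorm_nonneg _) hs.1)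
      have h2 : -1 ≤ s.2 * (v ⬝ᵥ s.1) := by
        have := abs_le.1 h1
        rcases hs.2 with h | h <;> rw [h] <;> linarith
      have h3 : -((1 + r) * c) ≤ s.2 * ((c • v) ⬝ᵥ s.1) - r * dualNorm p (c • v) := by
        refine le_trans ?_ hm
        have := mul_le_mul_of_nonneg_left
          (by linarith : -(1 + r) ≤ s.2 * (v ⬝ᵥ s.1) - r * dualNorm p v) hc
        linarith
      have h4 := hℓd h3
      have h5 : |ℓ (-((1 + r) * c)) - ℓ 0| ≤ |-((1 + r) * c) - 0| := by
        simpa [Real.dist_eq] using hℓL.dist_le_mul (-((1 + r) * c)) 0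
      rw [sub_zero, abs_neg, abs_of_nonneg hcoef] at h5
      have h6 := (abs_le.1 h5).2
      linarith
    · have hsE : s ∉ E := fun h => hsA (subset_toMeasurable D E h)
      obtain ⟨u, hu, eu⟩ := exists_mul_dotProduct_eq (p := p) hr hs.2 v s.1
      have hsg : s.2 = sgn (v ⬝ᵥ (s.1 + u)) := by
        by_contra hne
        refine hsE ⟨s.1 + u, ?_, hne⟩
        have := vecNorm_smul (p := p) (-1) u
        simp only [neg_smul, one_smul, abs_neg, abs_one, one_mul] at this
        rwa [sub_add_cancel_left, this]
      have h0 : 0 ≤ s.2 * (v ⬝ᵥ s.1) - r * dualNorm p v := by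
        rw [← eu, hsg, sgn]
        split_ifs <;> linarith
      by_cases hsF : s ∈ F
      · rw [Set.indicator_of_mem hsF]
        have := hℓd ((mul_nonneg hc h0).trans hm)
        linarith
      · have h1 : r + γ < |v ⬝ᵥ s.1| := not_le.1 hsF
        have h2 : |v ⬝ᵥ s.1| = s.2 * (v ⬝ᵥ s.1) := by
          have h3 : 0 ≤ s.2 * (v ⬝ᵥ s.1) := by
            have := mul_nonneg hr (dualNorm_nonneg (p := p) v)
            linarith
          rw [← abs_of_nonneg h3, abs_mul]
          rcases hs.2 with h | h <;> simp [h]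
        have h4 := hℓd ((mul_le_mul_of_nonneg_left
          (by linarith : γ ≤ s.2 * (v ⬝ᵥ s.1) - r * dualNorm p v) hc).trans hm)
        linarith
  have j1 : Integrable (A.indicator fun _ => ℓ 0 + (1 + r) * c) D :=
    (integrable_const _).indicator hAm
  have j2 : Integrable (F.indicator fun _ => ℓ 0) D := (integrable_const _).indicator hFm
  refine (integral_mono_ae (integrable_advLoss hℓL hD r _)
    ((j1.add j2).add (integrable_const _)) hpt).trans_eq ?_
  rw [integral_add' (j1.add j2) (integrable_const _), integral_add' j1 j2, integral_indicator_const _ hAm,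
    integral_indicator_const _ hFm, hAE]
  simp only [smul_eq_mul, integral_const, probReal_univ, one_mul]
  ring

/-- The robust margin is a linear form in a lifted feature vector, so the adversarial loss
concentrates uniformly over Euclidean balls. -/
theorem exists_measurableSet_advRisk_deviation {n : ℕ} (hn : 0 < n)
    (hD : ∀ᵐ s ∂D, s ∈ goodExamples d p) {r M ρ t : ℝ} (hr : 0 ≤ r) (hM0 : 0 < M)
    (hM : ∀ x : Fin d → ℝ, vecNorm 2 x ≤ M * vecNorm p x) (hρ : 0 < ρ) (ht : 0 ≤ t)
    {ψ : ℝ → ℝ} (hψ : LipschitzWith 1 ψ) :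
    ∃ E : Set (Fin n → (Fin d → ℝ) × ℝ), MeasurableSet E ∧
      (Measure.pi fun _ : Fin n => D).real Eᶜ
        ≤ 2 * Real.exp (-(n * t ^ 2 / (8 * (ρ * M * (1 + r)) ^ 2))) ∧
      ∀ S ∈ E, (∀ i, S i ∈ goodExamples d p) → ∀ w : Fin d → ℝ, vecNorm 2 w ≤ ρ →
        ∫ s, ψ (s.2 * (w ⬝ᵥ s.1) - r * dualNorm p w) ∂D ≤ advRisk p ψ r S w + t := by
  classical
  let lift : (Fin d → ℝ) → ℝ → WithLp 2 (EuclideanSpace ℝ (Fin d) × ℝ) := fun x c =>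
    WithLp.toLp 2 (WithLp.toLp 2 x, c)
  have hlift_norm : ∀ x c, ‖lift x c‖ ^ 2 = vecNorm 2 x ^ 2 + c ^ 2 := fun x c => by
    rw [WithLp.prod_norm_sq_eq_of_L2]
    simp [lift, vecNorm]
  have hlift_inner : ∀ x c y e, (inner ℝ (lift x c) (lift y e) : ℝ) = x ⬝ᵥ y + c * e :=
    fun x c y e => by
      rw [WithLp.prod_inner_apply]
      simp [lift, EuclideanSpace.inner_toLp_toLp, dotProduct_comm, mul_comm]
  have hlift_inner' : ∀ (W : WithLp 2 (EuclideanSpace ℝ (Fin d) × ℝ)) y e,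
      (inner ℝ W (lift y e) : ℝ) = (WithLp.ofLp W.fst) ⬝ᵥ y + W.snd * e := fun W y e => by
    rw [← hlift_inner]; rfl
  -- The extra coordinates `√r M` and `-(√r / M) ‖w‖_*` multiply to `-r ‖w‖_*`. This balance bounds
  -- the two norms by `M √(1 + r)` and `ρ √(1 + r)`. The value 0 off the good examples, a null set,
  -- makes the norm bound hold everywhere.
  let X : (Fin d → ℝ) × ℝ → WithLp 2 (EuclideanSpace ℝ (Fin d) × ℝ) := fun s =>
    if s ∈ goodExamples d p then lift (s.2 • s.1) (√r * M) else 0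
  let Wt : (Fin d → ℝ) → WithLp 2 (EuclideanSpace ℝ (Fin d) × ℝ) := fun w =>
    lift w (-(√r / M * dualNorm p w))
  have hsr : √r ^ 2 = r := Real.sq_sqrt hr
  have hs1 : √(1 + r) ^ 2 = 1 + r := Real.sq_sqrt (by linarith)
  have hXm : ∀ W, Measurable fun s => (inner ℝ W (X s) : ℝ) := fun W => by
    have e : (fun s => (inner ℝ W (X s) : ℝ)) = fun s => if s ∈ goodExamples d p then
        s.2 * (WithLp.ofLp W.fst ⬝ᵥ s.1) + W.snd * (√r * M) else 0 := by
      funext s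
      by_cases hs : s ∈ goodExamples d p
      · simp only [X, hs, if_true, hlift_inner', dotProduct_smul, smul_eq_mul]
      · simp only [X, hs, if_false, inner_zero_right]
    rw [e]
    exact Measurable.ite measurableSet_goodExamples
      ((measurable_mul_dotProduct _).add_const _) measurable_const
  have hX : ∀ s, ‖X s‖ ≤ M * √(1 + r) := fun s => by
    by_cases hs : s ∈ goodExamples d p
    · simp only [X, hs, if_true]
      refine le_of_sq_le_sq ?_ (by positivity)
      have h1 : vecNorm 2 (s.2 • s.1) ≤ M := by
        have h2 : |s.2| = 1 := by rcases hs.2 with h | h <;> simp [h]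
        rw [vecNorm_smul, h2, one_mul]
        exact (hM _).trans (mul_le_of_le_one_right hM0.le hs.1)
      have h3 := pow_le_pow_left₀ (vecNorm_nonneg _) h1 2
      rw [hlift_norm, mul_pow, mul_pow, hsr, hs1]
      linarith
    · simp only [X, hs, if_false, norm_zero]
      positivity
  have hWt : ∀ w, vecNorm 2 w ≤ ρ → ‖Wt w‖ ≤ ρ * √(1 + r) := fun w hw => by
    refine le_of_sq_le_sq ?_ (by positivity)
    have h1 := pow_le_pow_left₀ (vecNorm_nonneg _) hw 2
    have h2 : dualNorm p w / M ≤ ρ := by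
      rw [div_le_iff₀ hM0, mul_comm]
      exact (dualNorm_le_mul_vecNorm_two hM0.le hM w).trans (mul_le_mul_of_nonneg_left hw hM0.le)
    have h3 := pow_le_pow_left₀ (div_nonneg (dualNorm_nonneg w) hM0.le) h2 2
    have h4 : (-(√r / M * dualNorm p w)) ^ 2 = r * (dualNorm p w / M) ^ 2 := by
      calc _ = √r ^ 2 * (dualNorm p w / M) ^ 2 := by ring
        _ = _ := by rw [hsr]
    have h5 := mul_le_mul_of_nonneg_left h3 hr
    rw [hlift_norm, h4, mul_pow, hs1]
    linarith
  have hinner : ∀ w, ∀ s ∈ goodExamples d p,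
      (inner ℝ (Wt w) (X s) : ℝ) = s.2 * (w ⬝ᵥ s.1) - r * dualNorm p w := fun w s hs => by
    simp only [X, hs, if_true, Wt, hlift_inner, dotProduct_smul, smul_eq_mul]
    have : -(√r / M * dualNorm p w) * (√r * M) = -(√r ^ 2 * dualNorm p w) := by field_simp
    rw [this, hsr]
    ring
  have : FiniteDimensional ℝ (WithLp 2 (EuclideanSpace ℝ (Fin d) × ℝ)) :=
    (WithLp.linearEquiv 2 ℝ (EuclideanSpace ℝ (Fin d) × ℝ)).symm.finiteDimensional
  have : ProperSpace (WithLp 2 (EuclideanSpace ℝ (Fin d) × ℝ)) := FiniteDimensional.proper ℝ _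
  obtain ⟨E, hE, hEp, hES⟩ := exists_measurableSet_uniform_deviation D hn hXm hX hψ
    (Wt '' {w | vecNorm 2 w ≤ ρ}) (ρ := ρ * √(1 + r)) (t := t)
    (by rintro _ ⟨w, hw, rfl⟩; exact hWt w hw) (by positivity) ht
  have e : ρ * √(1 + r) * (M * √(1 + r)) = ρ * M * (1 + r) := by
    linear_combination ρ * M * hs1
  rw [e] at hEp
  refine ⟨E, hE, hEp, fun S hS hgood w hw => ?_⟩
  have h := hES S hS (Wt w) ⟨w, hw, rfl⟩
  have e1 : ∫ s, ψ (inner ℝ (Wt w) (X s)) ∂D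
      = ∫ s, ψ (s.2 * (w ⬝ᵥ s.1) - r * dualNorm p w) ∂D := by
    refine integral_congr_ae ?_
    filter_upwards [hD] with s hs
    simp only [hinner w s hs]
  rw [e1] at h
  refine h.trans_eq ?_
  rw [advRisk]
  congr 2
  exact Finset.sum_congr rfl fun i _ => by rw [hinner w _ (hgood i)]

end PopulationRisk

/-! ### Constants, confidence levels and the main theorem. -/

/-- Constants comparing the Euclidean norm with a pair of dual `ℓ_p`, `ℓ_q` norms. -/
theorem exists_vecNorm_two_comparison {d : ℕ} (hd : 0 < d) {p q : ℝ≥0∞} [Fact (1 ≤ p)]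
    [Fact (1 ≤ q)] (hpq : p⁻¹ + q⁻¹ = 1) :
    ∃ M : ℝ, 1 ≤ M ∧ (∀ x : Fin d → ℝ, vecNorm 2 x ≤ M * vecNorm p x) ∧
      (∀ v : Fin d → ℝ, M * vecNorm 2 v ≤ (d : ℝ) ^ |(q⁻¹).toReal - 1 / 2| * vecNorm q v) ∧
      4 * M ^ 2 ≤ if p ≤ 2 then 4 else 4 * (d : ℝ) := by
  have hd1 : (1 : ℝ) ≤ d := by exact_mod_cast hd
  have hp1 : p⁻¹ ≤ 1 := hpq ▸ le_self_add
  have hq1 : q⁻¹ ≤ 1 := hpq ▸ le_add_self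
  have hpt : p⁻¹ ≠ ∞ := ne_top_of_le_ne_top ENNReal.one_ne_top hp1
  have hqt : q⁻¹ ≠ ∞ := ne_top_of_le_ne_top ENNReal.one_ne_top hq1
  have hsum : (p⁻¹).toReal + (q⁻¹).toReal = 1 := by
    rw [← ENNReal.toReal_add hpt hqt, hpq, ENNReal.toReal_one]
  have htwo : ((2 : ℝ≥0∞)⁻¹).toReal = 1 / 2 := by simp
  have hle_iff : ∀ a : ℝ≥0∞, a⁻¹ ≠ ∞ → (a ≤ 2 ↔ 1 / 2 ≤ (a⁻¹).toReal) := fun a ha => by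
    rw [← htwo, ENNReal.toReal_le_toReal (by simp) ha, ENNReal.inv_le_inv]
  have hge_iff : ∀ a : ℝ≥0∞, a⁻¹ ≠ ∞ → (2 ≤ a ↔ (a⁻¹).toReal ≤ 1 / 2) := fun a ha => by
    rw [← htwo, ENNReal.toReal_le_toReal ha (by simp), ENNReal.inv_le_inv]
  by_cases hp : p ≤ 2
  · have h1 := (hle_iff p hpt).1 hp
    refine ⟨1, le_rfl, fun x => ?_, fun v => ?_, by simp [hp]⟩
    · rw [one_mul]; exact vecNorm_two_le_of_le_two hp x
    · rw [one_mul, abs_of_nonpos (by linarith), neg_sub]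
      exact vecNorm_two_le_of_two_le ((hge_iff q hqt).2 (by linarith)) v
  · have h1 : (p⁻¹).toReal < 1 / 2 := not_le.1 fun h => hp ((hle_iff p hpt).2 h)
    have hp0 : 0 ≤ (p⁻¹).toReal := ENNReal.toReal_nonneg
    have ha : |(q⁻¹).toReal - 1 / 2| = 1 / 2 - (p⁻¹).toReal := by
      rw [abs_of_nonneg (by linarith)]; linarith
    rw [ha]
    refine ⟨(d : ℝ) ^ (1 / 2 - (p⁻¹).toReal), Real.one_le_rpow hd1 (by linarith), fun x => ?_,
      fun v => ?_, ?_⟩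
    · exact vecNorm_two_le_of_two_le ((hge_iff p hpt).2 h1.le) x
    · exact mul_le_mul_of_nonneg_left
        (vecNorm_two_le_of_le_two ((hle_iff q hqt).2 (by linarith)) v) (by positivity)
    · rw [if_neg hp, ← Real.rpow_natCast, ← Real.rpow_mul (by positivity)]
      have : (d : ℝ) ^ ((1 / 2 - (p⁻¹).toReal) * (2 : ℕ)) ≤ (d : ℝ) ^ (1 : ℝ) :=
        Real.rpow_le_rpow_of_exponent_le hd1 (by push_cast; linarith)
      rw [Real.rpow_one] at this
      linarith

theorem robustErr_nonneg {d : ℕ} (D : Measure ((Fin d → ℝ) × ℝ)) (p : ℝ≥0∞) (r : ℝ)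
    (w : Fin d → ℝ) : 0 ≤ robustErr D p r w := measureReal_nonneg

theorem robustOpt_nonneg {d : ℕ} (D : Measure ((Fin d → ℝ) × ℝ)) (p q : ℝ≥0∞) (r : ℝ) :
    0 ≤ robustOpt D p q r := Real.iInf_nonneg fun w => robustErr_nonneg D p r w.1

theorem rademacherNorm_nonneg {d n : ℕ} (p : ℝ≥0∞) [Fact (1 ≤ p)] (x : Fin n → Fin d → ℝ) :
    0 ≤ rademacherNorm p x :=
  mul_nonneg (by positivity) (mul_nonneg (by positivity)
    (Finset.sum_nonneg fun _ _ => vecNorm_nonneg _))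

theorem two_mul_exp_deviation {n : ℕ} (hn : 0 < n) {G δ : ℝ} (hG : 0 < G) (hδ : 0 < δ)
    (hδ1 : δ < 1) :
    2 * Real.exp (-(n * (G * √(8 * Real.log (4 / δ) / n)) ^ 2 / (8 * G ^ 2))) = δ / 2 := by
  have hn' : (0 : ℝ) < n := by exact_mod_cast hn
  have hlog : 0 ≤ Real.log (4 / δ) := Real.log_nonneg ((one_le_div hδ).2 (by linarith))
  rw [mul_pow, Real.sq_sqrt (by positivity)]
  have e : n * (G ^ 2 * (8 * Real.log (4 / δ) / n)) / (8 * G ^ 2) = Real.log (4 / δ) := by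
    field_simp
  rw [e, Real.exp_neg, Real.exp_log (by positivity)]
  field_simp
  norm_num

/-- Since `δ < 1`, `log (4 / δ) ≤ 2 log (2 / δ)`, so each root is at most `4 √(L / n)`; then `4 (1 +
1 / 2) = 6`. -/
theorem deviation_add_half_le {n : ℕ} (hn : 0 < n) {G δ L : ℝ} (hG : 0 < G) (hδ : 0 < δ)
    (hδ1 : δ < 1) (hL : Real.log (2 / δ) ≤ L) :
    G * √(8 * Real.log (4 / δ) / n) + G / 2 * √(8 * Real.log (4 / δ) / n) ≤ 6 * G * √(L / n) := by
  have hn' : (0 : ℝ) < n := by exact_mod_cast hn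
  have h1 : Real.log (4 / δ) ≤ 2 * L := by
    have e : 4 / δ = 2 * (2 / δ) := by ring
    have h2 : Real.log 2 ≤ Real.log (2 / δ) :=
      Real.log_le_log (by norm_num) ((le_div_iff₀ hδ).2 (by linarith))
    rw [e, Real.log_mul (by norm_num) (by positivity)]
    linarith
  have h2 : √(8 * Real.log (4 / δ) / n) ≤ 4 * √(L / n) := by
    have e : 4 * √(L / n) = √(16 * (L / n)) := by
      rw [Real.sqrt_mul (by norm_num), show (16 : ℝ) = 4 ^ 2 by norm_num,
        Real.sqrt_sq (by norm_num)]
    rw [e]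
    refine Real.sqrt_le_sqrt ?_
    rw [← mul_div_assoc]
    exact div_le_div_of_nonneg_right (by linarith) hn'.le
  nlinarith

theorem advRisk_neg {d n : ℕ} (p : ℝ≥0∞) [Fact (1 ≤ p)] (ℓ : ℝ → ℝ) (r : ℝ)
    (S : Fin n → (Fin d → ℝ) × ℝ) (w : Fin d → ℝ) :
    advRisk p (fun u => -ℓ u) r S w = -advRisk p ℓ r S w := by
  simp [advRisk]

theorem le_measureReal_inter_inter {Ω : Type*} [MeasurableSpace Ω] {P : Measure Ω}
    [IsProbabilityMeasure P] {E₁ E₂ E₃ : Set Ω} (h₁ : MeasurableSet E₁) (h₂ : MeasurableSet E₂)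
    (h₃ : MeasurableSet E₃) {a b : ℝ} (ha : P.real E₁ᶜ ≤ a) (hb : P.real E₂ᶜ ≤ b)
    (hc : ∀ᵐ x ∂P, x ∈ E₃) : 1 - (a + b) ≤ P.real (E₁ ∩ E₂ ∩ E₃) := by
  have h := probReal_compl_eq_one_sub (μ := P) ((h₁.inter h₂).inter h₃)
  rw [Set.compl_inter, Set.compl_inter] at h
  have h0 : P.real E₃ᶜ = 0 := by
    have hz : P E₃ᶜ = 0 := mem_ae_iff.1 hc
    rw [Measure.real, hz, ENNReal.toReal_zero]
  have h4 := measureReal_union_le (μ := P) (E₁ᶜ ∪ E₂ᶜ) E₃ᶜ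
  have h5 := measureReal_union_le (μ := P) E₁ᶜ E₂ᶜ
  linarith

theorem theorem1 {d n : ℕ} (hn : 0 < n)
    -- the distribution of labelled examples
    (D : Measure ((Fin d → ℝ) × ℝ)) [IsProbabilityMeasure D]
    (p q : ℝ≥0∞) (hpq : p⁻¹ + q⁻¹ = 1)
    (hy : ∀ᵐ s ∂D, s.2 = 1 ∨ s.2 = -1)
    (hx : ∀ᵐ s ∂D, vecNorm p s.1 ≤ 1)
    -- the loss
    (ℓ : ℝ → ℝ) (hℓ0 : ∀ t, 0 ≤ ℓ t) (hℓc : ConvexOn ℝ Set.univ ℓ)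
    (hℓd : Antitone ℓ) (hℓL : LipschitzWith 1 ℓ)
    (r : ℝ) (hr : 0 ≤ r)
    -- an optimal robust halfspace and its soft margin function
    (v : Fin d → ℝ) (φ : ℝ → ℝ) (hφ : SoftMargin D q v φ)
    (hv : robustErr D p r v = robustOpt D p q r)
    -- accuracy, step size, margin, confidence
    (H : ℝ) (hH : H = if p ≤ 2 then 4 else 4 * (d : ℝ))
    (ε : ℝ) (hε : 0 < ε) (η : ℝ) (hη : 0 < η) (hηε : η ≤ ε * H⁻¹ / 4)
    (γ : ℝ) (hγ : 0 < γ) (hφγ : 1 < r + γ → 1 ≤ φ (r + γ))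
    (δ : ℝ) (hδ : 0 < δ)
    -- `z` is `ℓ⁻¹ ε`
    (z : ℝ) (hz : 0 ≤ z) (hℓz : ℓ z = ε)
    -- the number of iterations and the constants of the bound
    (K : ℝ) (hK : K = (d : ℝ) ^ |2 * (q⁻¹).toReal - 1| * ε⁻¹ * η⁻¹ * z ^ 2 * (γ ^ 2)⁻¹)
    (B : ℝ) (hB : B = ℓ 0 + 2 * (d : ℝ) ^ |(q⁻¹).toReal - 1 / 2| * (1 + r) * γ⁻¹ * z)
    (B' : ℝ) (hB' : B' = 2 * (d : ℝ) ^ |(q⁻¹).toReal - 1 / 2| * B) :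
    ∃ E : Set (Fin n → (Fin d → ℝ) × ℝ), MeasurableSet E ∧
      1 - δ ≤ (Measure.pi (fun _ : Fin n => D)).real E ∧
      ∀ S ∈ E, ∀ w : ℕ → Fin d → ℝ, w 0 = 0 → IsAdvTraining ℓ p r η S ⌊K⌋₊ w →
        ∃ k : ℕ, (k : ℝ) ≤ K ∧
          robustErr D p r (w k) ≤
            (1 + (ℓ 0)⁻¹ * (1 + r) * z * γ⁻¹) * robustOpt D p q r
            + φ (r + γ) + 2 * (ℓ 0)⁻¹ * ε
            + 4 * (ℓ 0)⁻¹ * B' * γ⁻¹ * z * rademacherNorm p (fun i => (S i).1)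
            + (ℓ 0)⁻¹ * (4 * B' * γ⁻¹ * z * r / √n
                + 6 * B * √(Real.log (2 * max 1 K / δ) / n)) := by
  have : Fact (1 ≤ p) := ⟨by
    have : p⁻¹ ≤ 1 := hpq ▸ le_self_add
    rwa [ENNReal.inv_le_one] at this⟩
  have : Fact (1 ≤ q) := ⟨by
    have : q⁻¹ ≤ 1 := hpq ▸ le_add_self
    rwa [ENNReal.inv_le_one] at this⟩
  obtain ⟨hv1, hsoft⟩ := hφ
  have hl0 : 0 < ℓ 0 := (hℓz ▸ hε).trans_le (hℓd hz)
  have hB0 : 0 ≤ B := by rw [hB]; positivity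
  have hB'0 : 0 ≤ B' := by rw [hB']; positivity
  have hK0 : 0 ≤ K := by rw [hK]; positivity
  have hOPT := robustOpt_nonneg D p q r
  have hT2 : 0 ≤ 2 * (ℓ 0)⁻¹ * ε := by positivity
  have hT3 : ∀ S : Fin n → (Fin d → ℝ) × ℝ,
      0 ≤ 4 * (ℓ 0)⁻¹ * B' * γ⁻¹ * z * rademacherNorm p (fun i => (S i).1) := fun S =>
    mul_nonneg (by positivity) (rademacherNorm_nonneg p _)
  have hT4 : 0 ≤ 4 * B' * γ⁻¹ * z * r / √n := by positivity
  rcases le_or_gt 1 δ with hδ1 | hδ1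
  · exact ⟨∅, MeasurableSet.empty, by simpa using hδ1, fun S hS => absurd hS (by simp)⟩
  -- For `r + γ > 1`, and below for `z = 0`, the right-hand side is at least 1 and `k = 0` serves.
  -- Afterwards `r ≤ 1`, which the bound `(M * (1 + r)) ^ 2 ≤ H` needs.
  rcases lt_or_ge 1 (r + γ) with hrγ | hrγ
  · refine ⟨Set.univ, MeasurableSet.univ, by simpa using hδ.le, fun S _ w _ _ =>
      ⟨0, by simpa using hK0, ?_⟩⟩
    have h1 : robustErr D p r (w 0) ≤ 1 := measureReal_le_one
    have h2 := hφγ hrγ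
    have h3 : 0 ≤ (1 + (ℓ 0)⁻¹ * (1 + r) * z * γ⁻¹) * robustOpt D p q r := by positivity
    have h4 : 0 ≤ (ℓ 0)⁻¹ * (4 * B' * γ⁻¹ * z * r / √n
        + 6 * B * √(Real.log (2 * max 1 K / δ) / n)) := by positivity
    linarith [hT3 S]
  have hφ0 : 0 ≤ φ (r + γ) :=
    (measureReal_nonneg).trans (hsoft (r + γ) ⟨by positivity, hrγ⟩)
  rcases hz.eq_or_lt with hz0 | hz0
  · refine ⟨Set.univ, MeasurableSet.univ, by simpa using hδ.le, fun S _ w _ _ =>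
      ⟨0, by simpa using hK0, ?_⟩⟩
    have h1 : robustErr D p r (w 0) ≤ 1 := measureReal_le_one
    have h2 : (ℓ 0)⁻¹ * ε = 1 := by rw [← hℓz, ← hz0, inv_mul_cancel₀ hl0.ne']
    have h3 : 0 ≤ (1 + (ℓ 0)⁻¹ * (1 + r) * z * γ⁻¹) * robustOpt D p q r := by positivity
    have h4 : 0 ≤ (ℓ 0)⁻¹ * (4 * B' * γ⁻¹ * z * r / √n
        + 6 * B * √(Real.log (2 * max 1 K / δ) / n)) := by positivity
    linarith [hT3 S]
  have hd : 0 < d := by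
    rcases Nat.eq_zero_or_pos d with rfl | h
    · have h0 : v = 0 • v := Subsingleton.elim _ _
      have := vecNorm_smul (p := q) 0 v
      rw [Subsingleton.elim ((0 : ℝ) • v) v, hv1] at this
      simp at this
    · exact h
  have hd1 : (1 : ℝ) ≤ d := by exact_mod_cast hd
  obtain ⟨M, hM1, hM, hMv, hMH⟩ := exists_vecNorm_two_comparison hd hpq
  rw [← hH] at hMH
  have hM0 : 0 < M := by linarith
  have hD : ∀ᵐ s ∂D, s ∈ goodExamples d p := by
    filter_upwards [hx, hy] with s h1 h2 using ⟨h1, h2⟩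
  set a := (d : ℝ) ^ |(q⁻¹).toReal - 1 / 2| with ha
  have ha0 : 0 < a := by positivity
  have ha2 : (d : ℝ) ^ |2 * (q⁻¹).toReal - 1| = a ^ 2 := by
    rw [ha, ← Real.rpow_natCast, ← Real.rpow_mul (by positivity)]
    congr 1
    rw [show 2 * (q⁻¹).toReal - 1 = ((q⁻¹).toReal - 1 / 2) * 2 by ring, abs_mul]
    norm_num
  -- With this scale a margin `γ` of `v` becomes a margin `z` of `V`, where the loss equals `ε`.
  set c := z * γ⁻¹ with hc
  have hc0 : 0 < c := by positivity
  have hcγ : c * γ = z := by rw [hc]; field_simp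
  set V := c • v with hV
  have hV2 : vecNorm 2 V = c * vecNorm 2 v := by rw [hV, vecNorm_smul, abs_of_pos hc0]
  have hMV : M * vecNorm 2 V ≤ a * c := by
    have := mul_le_mul_of_nonneg_left (hMv v) hc0.le
    rw [hv1] at this
    rw [hV2]
    linarith
  have hVa : vecNorm 2 V ≤ a * c :=
    (le_mul_of_one_le_left (vecNorm_nonneg _) hM1).trans hMV
  have hVρ : vecNorm 2 V ≤ a * c / M := (le_div_iff₀ hM0).2 (by linarith)
  set G := 2 * a * c * (1 + r) with hG
  have hG0 : 0 < G := by positivity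
  have hGB : G ≤ B := by
    have : B = ℓ 0 + G := by rw [hB, hG, hc]; ring
    linarith
  set t := G * √(8 * Real.log (4 / δ) / n) with ht
  set t' := G / 2 * √(8 * Real.log (4 / δ) / n) with ht'
  -- `E₁` bounds population by empirical loss on the ball containing the chosen iterate. `E₂`,
  -- applied to `-ℓ`, gives the reverse inequality for `V`; half the radius suffices there. Each
  -- event fails with probability at most `δ / 2`.
  obtain ⟨E₁, hE₁, hP₁, hdev₁⟩ := exists_measurableSet_advRisk_deviation (n := n) hn hD hr hM0 hM
    (ρ := 2 * (a * c / M)) (t := t) (by positivity) (by positivity) hℓL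
  obtain ⟨E₂, hE₂, hP₂, hdev₂⟩ := exists_measurableSet_advRisk_deviation (n := n) hn hD hr hM0 hM
    (ρ := a * c / M) (t := t') (by positivity) (by positivity) (ψ := fun u => -ℓ u)
    (LipschitzWith.of_dist_le_mul fun u w => by rw [dist_neg_neg]; exact hℓL.dist_le_mul u w)
  have e₁ : 2 * (a * c / M) * M * (1 + r) = G := by rw [hG]; field_simp
  have e₂ : a * c / M * M * (1 + r) = G / 2 := by rw [hG]; field_simp
  rw [e₁, ht, two_mul_exp_deviation hn hG0 hδ hδ1] at hP₁
  rw [e₂, ht', two_mul_exp_deviation hn (half_pos hG0) hδ hδ1] at hP₂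
  have hgood : MeasurableSet {S : Fin n → (Fin d → ℝ) × ℝ | ∀ i, S i ∈ goodExamples d p} := by
    have e : {S : Fin n → (Fin d → ℝ) × ℝ | ∀ i, S i ∈ goodExamples d p}
        = ⋂ i, (fun S => S i) ⁻¹' goodExamples d p := by
      ext S
      simp
    rw [e]
    exact MeasurableSet.iInter fun i => measurable_pi_apply i measurableSet_goodExamples
  have hgoodae : ∀ᵐ S ∂(Measure.pi fun _ : Fin n => D), ∀ i, S i ∈ goodExamples d p :=
    ae_all_iff.2 fun i => (Measure.quasiMeasurePreserving_eval (fun _ : Fin n => D) i).ae hD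
  refine ⟨E₁ ∩ E₂ ∩ {S | ∀ i, S i ∈ goodExamples d p}, (hE₁.inter hE₂).inter hgood, ?_, ?_⟩
  · have := le_measureReal_inter_inter hE₁ hE₂ hgood hP₁ hP₂ hgoodae
    linarith
  rintro S ⟨⟨hS₁, hS₂⟩, hS⟩ w hw0 hw
  have hVK : vecNorm 2 V ^ 2 ≤ η * ε * ((⌊K⌋₊ : ℕ) + 1) := by
    have h1 : (a * c) ^ 2 = η * ε * K := by
      rw [hK, ha2, hc]
      field_simp
    calc vecNorm 2 V ^ 2 ≤ (a * c) ^ 2 := pow_le_pow_left₀ (vecNorm_nonneg _) hVa 2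
      _ = η * ε * K := h1
      _ ≤ _ := mul_le_mul_of_nonneg_left (Nat.lt_floor_add_one K).le (by positivity)
  have hHM : (M * (1 + r)) ^ 2 ≤ H := by
    have h1 : 1 + r ≤ 2 := by linarith
    calc (M * (1 + r)) ^ 2 ≤ (M * 2) ^ 2 :=
          pow_le_pow_left₀ (by positivity) (mul_le_mul_of_nonneg_left h1 hM0.le) 2
      _ = 4 * M ^ 2 := by ring
      _ ≤ H := hMH
  obtain ⟨k, hkN, hrisk, hnorm⟩ := hw.exists_advRisk_le hℓd hℓL hn hr hη hM0.le hε hM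
    (lt_of_lt_of_le (by positivity) hHM) hHM hηε hS V hVK hw0
  refine ⟨k, (Nat.cast_le.2 hkN).trans (Nat.floor_le hK0), ?_⟩
  have k1 := mul_robustErr_le_integral hℓ0 hℓd hℓL hD r (w k)
  have k2 := hdev₁ S hS₁ hS (w k) (by linarith)
  have k3 := hdev₂ S hS₂ hS V hVρ
  rw [integral_neg, advRisk_neg] at k3
  have hvN : dualNorm p v ≤ 1 := dualNorm_le_of_forall zero_le_one fun x => by
    rw [← hv1]
    exact (le_abs_self _).trans (abs_dotProduct_le_vecNorm_mul hpq v x)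
  have k4 := integral_advLoss_smul_le (γ := γ) hℓ0 hℓd hℓL hD hr hc0.le hvN
  rw [hcγ, hℓz, hv] at k4
  have k5 := mul_le_mul_of_nonneg_left (hsoft (r + γ) ⟨by positivity, hrγ⟩) hl0.le
  have hL : Real.log (2 / δ) ≤ Real.log (2 * max 1 K / δ) := by
    refine Real.log_le_log (by positivity) (div_le_div_of_nonneg_right ?_ hδ.le)
    linarith [le_max_left 1 K]
  have k6 : t + t' ≤ 6 * B * √(Real.log (2 * max 1 K / δ) / n) :=
    (deviation_add_half_le hn hG0 hδ hδ1 hL).trans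
      (mul_le_mul_of_nonneg_right (by linarith) (Real.sqrt_nonneg _))
  -- One `ε` is the optimization excess, the other is `ℓ z`, the loss of `V` at margin `z`.
  have k7 : ℓ 0 * robustErr D p r (w k) ≤ (ℓ 0 + (1 + r) * c) * robustOpt D p q r
      + ℓ 0 * φ (r + γ) + 2 * ε + (4 * B' * γ⁻¹ * z * r / √n
        + 6 * B * √(Real.log (2 * max 1 K / δ) / n)) := by linarith
  have k8 := mul_le_mul_of_nonneg_left k7 (inv_nonneg.2 hl0.le)
  rw [inv_mul_cancel_left₀ hl0.ne'] at k8
  refine k8.trans ?_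
  have e : (ℓ 0)⁻¹ * ((ℓ 0 + (1 + r) * c) * robustOpt D p q r
      + ℓ 0 * φ (r + γ) + 2 * ε + (4 * B' * γ⁻¹ * z * r / √n
        + 6 * B * √(Real.log (2 * max 1 K / δ) / n)))
      = (1 + (ℓ 0)⁻¹ * (1 + r) * z * γ⁻¹) * robustOpt D p q r
            + φ (r + γ) + 2 * (ℓ 0)⁻¹ * ε
            + (ℓ 0)⁻¹ * (4 * B' * γ⁻¹ * z * r / √n
                + 6 * B * √(Real.log (2 * max 1 K / δ) / n)) := by
    linear_combination (robustOpt D p q r + φ (r + γ)) * inv_mul_cancel₀ hl0.ne'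
      + (ℓ 0)⁻¹ * (1 + r) * robustOpt D p q r * hc
  rw [e]
  linarith [hT3 S]
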